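/- Let $K\ge M\ge 1$ and $L\ge 1$ be integers, $K'=K-M$. Let $H_1,\dots,H_M$ be random $K\times M$ complex matrices such that, for each $m$, the entries of $H_m$ are i.i.d. circularly symmetric complex Gaussian $\mathcal{CN}(0,1)$. Let $R\succ 0$ be an $M\times M$ Hermitian matrix with eigendecomposition $R=U\,\mathrm{diag}\{\lambda_1,\dots,\lambda_M\}\,U^{\mathsf H}$, $U$ unitary. For a power budget $p>0$ let $s_m^\star=\max\{0,\frac1\nu-\frac1{L\lambda_m}\}$, where $\nu=\nu(p)>0$ is determined by $\sum_{m=1}^M s_m^\star=p$, and let $\Delta_{\rm s}=\mathrm{diag}\{s_1^\star,\dots,s_M^\star\}$. The sensing-centric (S-C) design uses the precoding matrix $W_{\rm s}=U\Delta_{\rm s}^{1/2}$, which maximizes $\log_2\det(I_M+L\,W^{\mathsf H}RW)$ over all $W\in\mathbb C^{M\times M}$ with $\mathrm{tr}(WW^{\mathsf H})\le p$. Let $\rho_m=|v_m^{\mathsf H}h_m|^2$, where $h_m$ is the $m$-th column of $A_m=H_mU$ and $v_m=q_m/\|q_m\|$ with $q_m$ the $m$-th column of $A_m(A_m^{\mathsf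 H}A_m)^{-1}$ (zero-forcing equalizer). Then each $\rho_m$ has the Gamma law with density $x^{K'}e^{-x}/K'!$ on $x>0$, and the sum ergodic communication rate $\mathcal R_{\rm c}^{\rm s}=\mathbb E\{\sum_{m=1}^M\log_2(1+s_m^\star\rho_m)\}$ is finite and equals $$\mathcal R_{\rm c}^{\rm s}=\sum_{m=1}^{M}\sum_{\mu=0}^{K'}\frac{(-1/s_m^\star)^{K'-\mu}}{(K'-\mu)!\,\ln 2}\left(-e^{1/s_m^\star}\,\mathrm{Ei}\!\left(-\frac1{s_m^\star}\right)+\sum_{i=1}^{K'-\mu}(i-1)!\left(-\frac1{s_m^\star}\right)^{-i}\right),$$ where $\mathrm{Ei}(x)=-\int_{-x}^{\infty}e^{-t}t^{-1}\,dt$ for $x<0$, and users $m$ with $s_m^\star=0$ contribute $0$. As $p\to\infty$, $$\mathcal R_{\rm c}^{\rm s}-M\left(\log_2 p-\log_2 M+\frac{\psi(K'+1)}{\ln 2}\right)\to 0,$$ where $\psi(x)=\frac{d}{dx}\ln\Gamma(x)$; in particular the high-SNR slope $\lim_{p\to\infty}\mathcal R_{\rm c}^{\rm s}/\log_2 p$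 equals $M$. -/

import Mathlib

open MeasureTheory ProbabilityTheory Filter Topology Matrix
open scoped Nat ComplexOrder

noncomputable section

/-- The circularly symmetric complex Gaussian law `CN(0,1)`: independent real and imaginary parts,
each centred Gaussian with variance `1/2`, so that the total variance is `1`. -/
def complexGaussian : Measure ℂ :=
  ((gaussianReal 0 (1 / 2)).prod (gaussianReal 0 (1 / 2))).map
    (fun z : ℝ × ℝ => (⟨z.1, z.2⟩ : ℂ))

/-- Rayleigh fading: the entries of the random `K × M` matrix `H` are i.i.d. `CN(0,1)`. -/
structure IsRayleigh {Ω : Type*} [MeasurableSpace Ω] (Pr : Measure Ω) {K M : ℕ}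
    (H : Ω → Matrix (Fin K) (Fin M) ℂ) : Prop where
  hasLaw : ∀ i j, HasLaw (fun ω => H ω i j) complexGaussian Pr
  indep : iIndepFun (fun (ij : Fin K × Fin M) (ω : Ω) => H ω ij.1 ij.2) Pr

/-- The zero-forcing direction `q_m`: the `m`-th column of `A (Aᴴ A)⁻¹`, where `A = H P` is the
effective channel. -/
def zfColumn {K M : ℕ} (P : Matrix (Fin M) (Fin M) ℂ) (H : Matrix (Fin K) (Fin M) ℂ) (m : Fin M) :
    EuclideanSpace ℂ (Fin K) :=
  WithLp.toLp 2 (fun k => ((H * P) * ((H * P)ᴴ * (H * P))⁻¹) k m)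

/-- The normalized zero-forcing equalizer `v_m = q_m / ‖q_m‖`. -/
def zfEqualizer {K M : ℕ} (P : Matrix (Fin M) (Fin M) ℂ) (H : Matrix (Fin K) (Fin M) ℂ)
    (m : Fin M) : EuclideanSpace ℂ (Fin K) :=
  ((‖zfColumn P H m‖⁻¹ : ℝ) : ℂ) • zfColumn P H m

/-- The channel gain after zero forcing, `|v_mᴴ h_m|²` with `h_m` the `m`-th column of `H P`. -/
def zfGain {K M : ℕ} (P : Matrix (Fin M) (Fin M) ℂ) (H : Matrix (Fin K) (Fin M) ℂ)
    (m : Fin M) : ℝ :=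
  ‖∑ k, star (zfEqualizer P H m k) * (H * P) k m‖ ^ 2

/-- The sum communication rate `∑ log₂ (1 + p_m |v_mᴴ h_m|²)` for normalized precoders `P` (the
columns), powers `s`, and channel matrices `H m`. -/
def sumCommRate {K M : ℕ} (P : Matrix (Fin M) (Fin M) ℂ) (s : Fin M → ℝ)
    (H : Fin M → Matrix (Fin K) (Fin M) ℂ) : ℝ :=
  ∑ m, Real.logb 2 (1 + s m * zfGain P (H m) m)

/-- The precoding matrix `W = P Ξ^{1/2}` with `Ξ = diag(s)`. -/
def precoder {M : ℕ} (P : Matrix (Fin M) (Fin M) ℂ) (s : Fin M → ℝ) : Matrix (Fin M) (Fin M) ℂ :=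
  P * Matrix.diagonal (fun m => ((Real.sqrt (s m) : ℝ) : ℂ))

/-- The sensing objective `log₂ det (I + L Wᴴ R W)` (the determinant is a positive real). -/
def sensingObjective {M : ℕ} (L : ℕ) (R W : Matrix (Fin M) (Fin M) ℂ) : ℝ :=
  Real.logb 2 (1 + (L : ℂ) • (Wᴴ * R * W)).det.re

/-- The precoding matrices that meet the power budget `tr (W Wᴴ) ≤ p`. -/
def feasiblePrecoders (M : ℕ) (p : ℝ) : Set (Matrix (Fin M) (Fin M) ℂ) :=
  {W | (W * Wᴴ).trace.re ≤ p}

/-- The water-filling power `max {0, 1/ν - 1/(L λ_m)}` at water level `1/ν`. -/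
def waterFill {M : ℕ} (L : ℕ) (lam : Fin M → ℝ) (ν : ℝ) (m : Fin M) : ℝ :=
  max 0 (1 / ν - 1 / (L * lam m))

/-- The exponential integral `Ei(x) = -∫_{-x}^∞ e^{-t}/t dt`, for `x < 0`. -/
def expIntegralEi (x : ℝ) : ℝ :=
  -∫ t in Set.Ioi (-x), Real.exp (-t) / t

/-- The digamma function `ψ(x) = d/dx ln Γ(x)` of a real argument. -/
def realDigamma (x : ℝ) : ℝ :=
  deriv (fun y : ℝ => Real.log (Real.Gamma y)) x

end

/-! Gains. An i.i.d. `CN(0,1)` vector is invariant under unitary maps, because its characteristic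
function depends only on the norm of its argument. Hence the columns of `H U` are again independent
Gaussian vectors. The zero-forcing vector is orthogonal to every column but the `m`-th, so the gain
is the squared norm of the projection of `h_m` onto the orthogonal complement of the other `M - 1`
columns (`zfGain_eq_sum_norm_sq`). With those columns frozen, the projection has `K - M + 1` i.i.d.
`CN(0,1)` coordinates, and the law of its squared norm is the same Gamma law whatever the frozen
columns are (`measurePreserving_zfGain`).

Rate. Integrating `log (1 + s x)` by parts against the Gamma tail `e^{-x} ∑ x^k / k!` leaves the
integrals of `x^k e^{-x} / (x + 1/s)`, which a recursion in `k` reduces to `Ei`. At high SNR, `E log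
(1 + s ρ) - log s = E log (1/s + ρ)` tends to `E log ρ = ψ(K' + 1)`, and every water-filling power
stays within a constant of `p / M`.

Optimality. `log det` lies below its tangent plane at a diagonal matrix
(`Matrix.PosDef.log_det_re_le_sum`); at the water-filling point the slopes satisfy the KKT
conditions with multiplier `ν`. -/

/-! ### Complex Gaussian vectors and their unitary invariance -/

instance isProbabilityMeasure_complexGaussian : IsProbabilityMeasure complexGaussian :=
  Measure.isProbabilityMeasure_map
    (Complex.measurableEquivRealProd.symm.measurable.aemeasurable)

theorem integral_complexGaussian {F : Type*} [NormedAddCommGroup F] [NormedSpace ℝ F]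
    (f : ℂ → F) :
    ∫ z, f z ∂complexGaussian =
      ∫ z : ℝ × ℝ, f ⟨z.1, z.2⟩ ∂((gaussianReal 0 (1 / 2)).prod (gaussianReal 0 (1 / 2))) :=
  integral_map_equiv Complex.measurableEquivRealProd.symm f

theorem charFun_complexGaussian (t : ℂ) :
    charFun complexGaussian t = Complex.exp (-(‖t‖ ^ 2 / 4 : ℝ)) := by
  rw [charFun_apply, integral_complexGaussian]
  have h : ∀ z : ℝ × ℝ, Complex.exp ((inner ℝ (⟨z.1, z.2⟩ : ℂ) t : ℝ) * Complex.I) =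
      Complex.exp (t.re * z.1 * Complex.I) * Complex.exp (t.im * z.2 * Complex.I) := by
    intro z
    rw [← Complex.exp_add]
    congr 1
    simp [Complex.inner, Complex.mul_re]
    ring
  simp_rw [h]
  rw [integral_prod_mul (fun x : ℝ => Complex.exp (t.re * x * Complex.I))
    (fun x : ℝ => Complex.exp (t.im * x * Complex.I)), ← charFun_apply_real,
    ← charFun_apply_real, charFun_gaussianReal, charFun_gaussianReal, ← Complex.exp_add]
  congr 1
  rw [← Complex.normSq_eq_norm_sq, Complex.normSq_apply]
  push_cast
  simp
  ring

theorem charFun_pi_complexGaussian {ι : Type*} [Fintype ι] (t : EuclideanSpace ℂ ι) :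
    charFun ((Measure.pi fun _ : ι => complexGaussian).map (WithLp.toLp 2)) t =
      Complex.exp (-(‖t‖ ^ 2 / 4 : ℝ)) := by
  rw [charFun_pi]
  simp_rw [charFun_complexGaussian]
  rw [← Complex.exp_sum, EuclideanSpace.norm_sq_eq]
  congr 1
  push_cast
  rw [Finset.sum_neg_distrib, Finset.sum_div]

/-- Characteristic functions pair through the real inner product, whereas orthonormality below is
complex. -/
theorem EuclideanSpace.real_inner_eq_re_inner_complex {ι : Type*} [Fintype ι]
    (x y : EuclideanSpace ℂ ι) : (inner ℝ x y : ℝ) = (inner ℂ x y : ℂ).re := by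
  simp [PiLp.inner_apply, Complex.inner, mul_comm]

/-- The characteristic function of the image at `t` is that of the original vector at `∑ t_i v_i`,
which has the norm of `t`. The family need not be a basis, so this covers projections as well as
unitary maps. -/
theorem measurePreserving_inner_orthonormal {ι κ : Type*} [Fintype ι] [Fintype κ]
    {v : ι → EuclideanSpace ℂ κ} (hv : Orthonormal ℂ v) :
    MeasurePreserving (fun (h : κ → ℂ) i => inner ℂ (v i) (WithLp.toLp 2 h))
      (Measure.pi fun _ => complexGaussian) (Measure.pi fun _ => complexGaussian) := by
  have hmeas : Measurable (fun (h : κ → ℂ) i => inner ℂ (v i) (WithLp.toLp 2 h)) := by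
    refine measurable_pi_lambda _ fun i => ?_
    fun_prop
  refine ⟨hmeas, ?_⟩
  apply (MeasurableEquiv.toLp 2 (ι → ℂ)).map_measurableEquiv_injective
  apply Measure.ext_of_charFun
  ext t
  change charFun (Measure.map (WithLp.toLp 2) _) t = charFun (Measure.map (WithLp.toLp 2) _) t
  rw [charFun_pi_complexGaussian]
  have hn : ‖∑ i, t i • v i‖ ^ 2 = ‖t‖ ^ 2 := by
    rw [EuclideanSpace.norm_sq_eq t, ← Complex.ofReal_inj]
    have := hv.inner_sum (fun i => t i) (fun i => t i) Finset.univ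
    rw [inner_self_eq_norm_sq_to_K] at this
    push_cast
    rw [show (Complex.ofReal ‖∑ i, t i • v i‖) = ((‖∑ i, t i • v i‖ : ℝ) : ℂ) from rfl]
    refine this.trans (Finset.sum_congr rfl fun i _ => ?_)
    rw [Complex.conj_mul']
  rw [← hn, ← charFun_pi_complexGaussian, charFun_apply, charFun_apply,
    integral_map (by fun_prop) (by fun_prop), integral_map (by fun_prop) (by fun_prop),
    integral_map (by fun_prop) (by fun_prop)]
  refine integral_congr_ae (ae_of_all _ fun h => ?_)
  dsimp only
  congr 3
  rw [EuclideanSpace.real_inner_eq_re_inner_complex,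
    EuclideanSpace.real_inner_eq_re_inner_complex, inner_sum, PiLp.inner_apply]
  congr 1
  refine Finset.sum_congr rfl fun i _ => ?_
  rw [inner_smul_right, ← inner_conj_symm (WithLp.toLp 2 h)]
  simp

/-! ### Squared norms of Gaussian vectors are Gamma distributed -/

theorem integral_exp_sq_complexGaussian (s : ℝ) :
    ∫ z, Complex.exp ((s * ‖z‖ ^ 2 : ℝ) * Complex.I) ∂complexGaussian =
      (1 - s * Complex.I)⁻¹ := by
  rw [integral_complexGaussian]
  have h : ∀ z : ℝ × ℝ, Complex.exp ((s * ‖(⟨z.1, z.2⟩ : ℂ)‖ ^ 2 : ℝ) * Complex.I) =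
      Complex.exp (s * z.1 ^ 2 * Complex.I) * Complex.exp (s * z.2 ^ 2 * Complex.I) := by
    intro z
    rw [← Complex.exp_add, ← Complex.normSq_eq_norm_sq, Complex.normSq_apply]
    congr 1
    push_cast
    ring
  simp_rw [h]
  rw [integral_prod_mul (fun x : ℝ => Complex.exp (s * x ^ 2 * Complex.I))
    (fun x : ℝ => Complex.exp (s * x ^ 2 * Complex.I))]
  have hre : 0 < (1 - s * Complex.I).re := by simp
  have hne : (1 - s * Complex.I) ≠ 0 := fun h0 => by simp [h0] at hre
  have hpi : (Real.pi : ℂ) ≠ 0 := by exact_mod_cast Real.pi_ne_zero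
  have hint : ∫ x : ℝ, Complex.exp (s * x ^ 2 * Complex.I) ∂(gaussianReal 0 (1 / 2)) =
      ((√Real.pi)⁻¹ : ℝ) * (Real.pi / (1 - s * Complex.I)) ^ (1 / 2 : ℂ) := by
    rw [integral_gaussianReal_eq_integral_smul (by norm_num), ← integral_gaussian_complex hre,
      ← integral_const_mul]
    refine integral_congr_ae (ae_of_all _ fun x => ?_)
    simp only [gaussianPDFReal, Complex.real_smul]
    push_cast
    rw [mul_assoc]
    congr 1
    · have h2 : (√2 : ℂ) ≠ 0 := by simp
      norm_num
      field_simp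
    · rw [← Complex.exp_add]
      congr 1
      norm_num
      ring
  -- The real and imaginary parts give the same square root, so its branch does not matter in the
  -- product.
  rw [hint, mul_mul_mul_comm, ← Complex.cpow_add _ _ (div_ne_zero hpi hne), ← Complex.ofReal_mul,
    ← mul_inv, Real.mul_self_sqrt Real.pi_pos.le]
  norm_num
  field_simp

theorem integrableOn_pow_mul_exp_neg_mul (n : ℕ) {b : ℝ} (hb : 0 < b) :
    IntegrableOn (fun x : ℝ => x ^ n * Real.exp (-(b * x))) (Set.Ioi 0) := by
  refine (integrableOn_rpow_mul_exp_neg_mul_rpow (s := n) (p := 1) (b := b)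
    (by linarith [n.cast_nonneg (α := ℝ)]) one_pos hb).congr_fun (fun x _ => ?_) measurableSet_Ioi
  simp

theorem tendsto_pow_mul_exp_neg_mul_atTop (n : ℕ) {b : ℝ} (hb : 0 < b) :
    Tendsto (fun x : ℝ => x ^ n * Real.exp (-(b * x))) atTop (𝓝 0) := by
  have h := (Real.tendsto_pow_mul_exp_neg_atTop_nhds_zero n).comp (tendsto_id.const_mul_atTop hb)
  have h2 := h.const_mul ((b ^ n)⁻¹)
  rw [mul_zero] at h2
  refine h2.congr fun x => ?_
  simp only [Function.comp, id, mul_pow]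
  field_simp

theorem integral_pow_mul_cexp_neg_mul_Ioi (n : ℕ) {c : ℂ} (hc : 0 < c.re) :
    ∫ x : ℝ in Set.Ioi 0, (x : ℂ) ^ n * Complex.exp (-(c * x)) = n ! * c⁻¹ ^ (n + 1) := by
  have hc0 : c ≠ 0 := fun h0 => by simp [h0] at hc
  have hint : ∀ k : ℕ, IntegrableOn (fun x : ℝ => (x : ℂ) ^ k * Complex.exp (-(c * x)))
      (Set.Ioi 0) := by
    intro k
    refine (integrableOn_pow_mul_exp_neg_mul k hc).mono' (by fun_prop) ?_
    refine (ae_restrict_iff' measurableSet_Ioi).2 (ae_of_all _ fun x hx => ?_)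
    rw [norm_mul, norm_pow, Complex.norm_exp, Complex.norm_real, Real.norm_of_nonneg hx.le]
    simp
  induction n with
  | zero =>
    have := integral_exp_mul_complex_Ioi (a := -c) (by simpa using hc) 0
    simp only [neg_mul] at this
    simp [this, neg_div_neg_eq]
  | succ n ih =>
    have hd : ∀ x ∈ Set.Ioi (0 : ℝ), HasDerivAt
        (fun x : ℝ => (x : ℂ) ^ (n + 1) * Complex.exp (-(c * x)))
        ((n + 1 : ℂ) * ((x : ℂ) ^ n * Complex.exp (-(c * x))) -
          c * ((x : ℂ) ^ (n + 1) * Complex.exp (-(c * x)))) x := by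
      intro x _
      have h1 : HasDerivAt (fun z : ℂ => z ^ (n + 1) * Complex.exp (-(c * z)))
          ((n + 1 : ℂ) * ((x : ℂ) ^ n * Complex.exp (-(c * x))) -
          c * ((x : ℂ) ^ (n + 1) * Complex.exp (-(c * x)))) x := by
        refine ((hasDerivAt_pow (n + 1) (x : ℂ)).mul
          ((hasDerivAt_id (x : ℂ)).const_mul c).neg.cexp).congr_deriv ?_
        simp
        ring
      exact h1.comp_ofReal
    have hlim : Tendsto (fun x : ℝ => (x : ℂ) ^ (n + 1) * Complex.exp (-(c * x))) atTop (𝓝 0) := by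
      rw [tendsto_zero_iff_norm_tendsto_zero]
      refine (tendsto_pow_mul_exp_neg_mul_atTop (n + 1) hc).congr' ?_
      filter_upwards [eventually_ge_atTop 0] with x hx
      rw [norm_mul, norm_pow, Complex.norm_exp, Complex.norm_real, Real.norm_of_nonneg hx]
      simp
    have key := integral_Ioi_of_hasDerivAt_of_tendsto (Continuous.continuousWithinAt (by fun_prop)) hd
      (((hint n).const_mul _).sub ((hint (n + 1)).const_mul _)) hlim
    rw [integral_sub ((hint n).const_mul _) ((hint (n + 1)).const_mul _), integral_const_mul,
      integral_const_mul, ih] at key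
    simp only [Complex.ofReal_zero, ne_eq, Nat.add_eq_zero_iff, one_ne_zero, and_false,
      not_false_eq_true, zero_pow, zero_mul, sub_zero] at key
    rw [← mul_right_inj' hc0, ← sub_eq_zero.1 key, Nat.factorial_succ]
    push_cast
    simp only [pow_succ]
    field_simp

theorem charFun_gammaMeasure_nat (n : ℕ) (s : ℝ) :
    charFun (gammaMeasure ((n : ℝ) + 1) 1) s = ((1 - s * Complex.I)⁻¹) ^ (n + 1) := by
  have hre : 0 < (1 - s * Complex.I).re := by simp
  have hn : (0 : ℝ) < (n : ℝ) + 1 := by positivity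
  rw [charFun_apply_real, gammaMeasure,
    integral_withDensity_eq_integral_toReal_smul₀
      (f := gammaPDF ((n : ℝ) + 1) 1) (measurable_gammaPDFReal _ _).ennreal_ofReal.aemeasurable
      (ae_of_all _ fun _ => ENNReal.ofReal_lt_top)]
  have h1 : ∀ x : ℝ, (gammaPDF ((n : ℝ) + 1) 1 x).toReal • Complex.exp (s * x * Complex.I) =
      (Set.Ici (0 : ℝ)).indicator (fun x : ℝ => ((n ! : ℝ) : ℂ)⁻¹ *
        ((x : ℂ) ^ n * Complex.exp (-((1 - s * Complex.I) * x)))) x := by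
    intro x
    rw [gammaPDF, ENNReal.toReal_ofReal (gammaPDFReal_nonneg hn one_pos x), gammaPDFReal]
    by_cases hx : 0 ≤ x
    · rw [Set.indicator_of_mem (show x ∈ Set.Ici 0 from hx), if_pos hx, Real.Gamma_nat_eq_factorial]
      simp only [add_sub_cancel_right, Complex.real_smul, Real.one_rpow, Real.rpow_natCast]
      push_cast
      rw [one_div, mul_assoc, mul_assoc, ← Complex.exp_add]
      congr 3
      ring
    · rw [Set.indicator_of_notMem (by simpa using hx), if_neg hx, zero_smul]
  simp_rw [h1]
  rw [integral_indicator measurableSet_Ici, integral_Ici_eq_integral_Ioi, integral_const_mul,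
    integral_pow_mul_cexp_neg_mul_Ioi n hre]
  have : (n ! : ℂ) ≠ 0 := by exact_mod_cast n.factorial_ne_zero
  push_cast
  field_simp

/-- Each squared modulus is a unit exponential; by independence the characteristic functions
multiply to that of the Gamma law. -/
theorem measurePreserving_sum_norm_sq (n : ℕ) :
    MeasurePreserving (fun z : Fin (n + 1) → ℂ => ∑ i, ‖z i‖ ^ 2)
      (Measure.pi fun _ => complexGaussian) (gammaMeasure ((n : ℝ) + 1) 1) := by
  have hmeas : Measurable (fun z : Fin (n + 1) → ℂ => ∑ i, ‖z i‖ ^ 2) := by fun_prop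
  have := isProbabilityMeasure_gammaMeasure (a := (n : ℝ) + 1) (by positivity) one_pos
  refine ⟨hmeas, ?_⟩
  have := Measure.isProbabilityMeasure_map (μ := Measure.pi fun _ => complexGaussian)
    hmeas.aemeasurable
  apply Measure.ext_of_charFun
  ext s
  rw [charFun_gammaMeasure_nat, charFun_apply_real, integral_map hmeas.aemeasurable (by fun_prop)]
  have h : ∀ z : Fin (n + 1) → ℂ, Complex.exp (s * (∑ i, ‖z i‖ ^ 2 : ℝ) * Complex.I) =
      ∏ i, Complex.exp ((s * ‖z i‖ ^ 2 : ℝ) * Complex.I) := by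
    intro z
    rw [← Complex.exp_sum]
    congr 1
    push_cast
    rw [Finset.mul_sum, Finset.sum_mul]
  simp_rw [h]
  rw [integral_fintype_prod_eq_prod (fun _ (z : ℂ) => Complex.exp ((s * ‖z‖ ^ 2 : ℝ) * Complex.I))]
  simp_rw [integral_exp_sq_complexGaussian, Finset.prod_const, Finset.card_univ, Fintype.card_fin]

/-! ### The zero-forcing gain and its law -/

theorem exists_orthonormal_orthogonal {K n d : ℕ} (hK : K = n + d) {b : Fin n → Fin K → ℂ}
    (hb : LinearIndependent ℂ b) :
    ∃ v : Fin d → EuclideanSpace ℂ (Fin K), Orthonormal ℂ v ∧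
      (∀ i j, inner ℂ (v i) (WithLp.toLp 2 (b j)) = 0) ∧
      ∀ q : EuclideanSpace ℂ (Fin K), (∀ j, inner ℂ (WithLp.toLp 2 (b j)) q = 0) →
        q = ∑ i, inner ℂ (v i) q • v i := by
  set B : Fin n → EuclideanSpace ℂ (Fin K) := fun j => WithLp.toLp 2 (b j) with hB
  have hBind : LinearIndependent ℂ B :=
    hb.map' (WithLp.linearEquiv 2 ℂ (Fin K → ℂ)).symm.toLinearMap (LinearEquiv.ker _)
  set W : Submodule ℂ (EuclideanSpace ℂ (Fin K)) := (Submodule.span ℂ (Set.range B))ᗮ with hW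
  have hfin : Module.finrank ℂ W = d := by
    have h1 := (Submodule.span ℂ (Set.range B)).finrank_add_finrank_orthogonal
    rw [finrank_span_eq_card hBind, finrank_euclideanSpace, Fintype.card_fin, Fintype.card_fin,
      ← hW] at h1
    omega
  let e := (stdOrthonormalBasis ℂ W).reindex (finCongr hfin)
  refine ⟨fun i => (e i : EuclideanSpace ℂ (Fin K)), ?_, fun i j => ?_, fun q hq => ?_⟩
  · exact e.orthonormal.comp_linearIsometry W.subtypeₗᵢ
  · exact (Submodule.mem_orthogonal' _ _).1 (e i).2 _ (Submodule.subset_span ⟨j, rfl⟩)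
  · have hqW : q ∈ W := by
      rw [hW, Submodule.mem_orthogonal]
      intro u hu
      induction hu using Submodule.span_induction with
      | mem x hx => obtain ⟨j, rfl⟩ := hx; exact hq j
      | zero => simp
      | add x y _ _ hx hy => rw [inner_add_left, hx, hy, add_zero]
      | smul c x _ hx => rw [inner_smul_left, hx, mul_zero]
    have := congrArg (fun w : W => (w : EuclideanSpace ℂ (Fin K))) (e.sum_repr' ⟨q, hqW⟩)
    simpa using this.symm

theorem zfGain_mul_one {K M : ℕ} (P : Matrix (Fin M) (Fin M) ℂ) (H : Matrix (Fin K) (Fin M) ℂ)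
    (m : Fin M) : zfGain P H m = zfGain 1 (H * P) m := by
  simp [zfGain, zfEqualizer, zfColumn]

/-- Put `α = (Aᴴ A)⁻¹ m m` and let `S` be the right-hand side. Since `⟨a_j, q⟩ = δ_{jm}`, the vector
`q` lies in the span of the `v_i`, with coordinates `α ⟨v_i, a_m⟩`. Thus `α S = 1` and `‖q‖² = |α|²
S`, and the gain is `‖q‖⁻² = S`. -/
theorem zfGain_eq_sum_norm_sq {K n d : ℕ} (m : Fin (n + 1)) {a : Fin (n + 1) → Fin K → ℂ}
    (ha : LinearIndependent ℂ a) {v : Fin d → EuclideanSpace ℂ (Fin K)} (hv : Orthonormal ℂ v)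
    (hvb : ∀ i j, inner ℂ (v i) (WithLp.toLp 2 (a (m.succAbove j))) = 0)
    (hspan : ∀ q : EuclideanSpace ℂ (Fin K),
      (∀ j, inner ℂ (WithLp.toLp 2 (a (m.succAbove j))) q = 0) → q = ∑ i, inner ℂ (v i) q • v i) :
    zfGain 1 (Matrix.of fun k j => a j k) m =
      ∑ i, ‖inner ℂ (v i) (WithLp.toLp 2 (a m))‖ ^ 2 := by
  set A : Matrix (Fin K) (Fin (n + 1)) ℂ := Matrix.of fun k j => a j k with hA
  set q := zfColumn 1 A m with hq
  set B := (Aᴴ * A)⁻¹ with hB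
  have hdet : IsUnit (Aᴴ * A).det := by
    have hinj : Function.Injective A.mulVec := Matrix.mulVec_injective_iff.2 ha
    exact (Matrix.isUnit_iff_isUnit_det _).1 (Matrix.PosDef.conjTranspose_mul_self A hinj).isUnit
  have hqk : ∀ k, q k = (A * B) k m := by
    intro k
    simp [hq, zfColumn, hB]
  have hqa : ∀ j, inner ℂ (WithLp.toLp 2 (a j)) q = if j = m then 1 else 0 := by
    intro j
    have h1 : (Aᴴ * (A * B)) j m = (1 : Matrix (Fin (n + 1)) (Fin (n + 1)) ℂ) j m := by
      rw [← Matrix.mul_assoc, hB, Matrix.mul_nonsing_inv _ hdet]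
    rw [Matrix.one_apply, Matrix.mul_apply] at h1
    rw [← h1, PiLp.inner_apply]
    refine Finset.sum_congr rfl fun k _ => ?_
    rw [hqk, RCLike.inner_apply, Matrix.conjTranspose_apply]
    simp [hA, mul_comm]
  have hqsum : q = ∑ j, B j m • (WithLp.toLp 2 (a j) : EuclideanSpace ℂ (Fin K)) := by
    ext k
    rw [hqk, Matrix.mul_apply]
    simp [hA, mul_comm]
  have hc : ∀ i, inner ℂ (v i) q = B m m * inner ℂ (v i) (WithLp.toLp 2 (a m)) := by
    intro i
    rw [hqsum, inner_sum, Fin.sum_univ_succAbove _ m]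
    simp [inner_smul_right, hvb]
  have hqv := hspan q fun j => by rw [hqa, if_neg (Fin.succAbove_ne m j)]
  set α := B m m with hα
  set S : ℝ := ∑ i, ‖inner ℂ (v i) (WithLp.toLp 2 (a m))‖ ^ 2 with hS
  have h1 : α * (S : ℂ) = 1 := by
    have := hqa m
    rw [if_pos rfl, hqv, inner_sum] at this
    rw [← this, hS]
    push_cast
    rw [Finset.mul_sum]
    refine Finset.sum_congr rfl fun i _ => ?_
    rw [inner_smul_right, hc, mul_assoc, ← Complex.conj_mul', inner_conj_symm, mul_comm (inner ℂ _ _)]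
  have h2 : ‖q‖ ^ 2 = ‖α‖ ^ 2 * S := by
    have := hv.inner_sum (fun i => inner ℂ (v i) q) (fun i => inner ℂ (v i) q) Finset.univ
    rw [← hqv, inner_self_eq_norm_sq_to_K] at this
    rw [← Complex.ofReal_inj, hS]
    push_cast
    refine this.trans ?_
    rw [Finset.mul_sum]
    refine Finset.sum_congr rfl fun i _ => ?_
    rw [Complex.conj_mul', hc, norm_mul]
    push_cast
    ring
  have h3 : ∑ k, star (zfEqualizer 1 A m k) * (A * (1 : Matrix (Fin (n + 1)) (Fin (n + 1)) ℂ)) k m =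
      ((‖q‖⁻¹ : ℝ) : ℂ) * (starRingEnd ℂ) (inner ℂ (WithLp.toLp 2 (a m)) q) := by
    rw [inner_conj_symm, PiLp.inner_apply, Finset.mul_sum]
    refine Finset.sum_congr rfl fun k _ => ?_
    simp only [zfEqualizer, ← hq, PiLp.smul_apply, smul_eq_mul, star_mul', Matrix.mul_one,
      RCLike.inner_apply]
    simp [hA]
    ring
  have hSpos : 0 ≤ S := Finset.sum_nonneg fun _ _ => by positivity
  have hn : ‖α‖ * S = 1 := by
    have := congrArg norm h1
    rwa [norm_mul, Complex.norm_real, Real.norm_of_nonneg hSpos, norm_one] at this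
  have hS0 : S ≠ 0 := fun h0 => by simp [h0] at hn
  rw [zfGain, h3, hqa, if_pos rfl]
  simp only [map_one, mul_one, Complex.norm_real, norm_inv, norm_norm, inv_pow]
  rw [h2, sq, mul_assoc, hn, mul_one]
  exact (eq_inv_of_mul_eq_one_right hn).symm

theorem measurePreserving_insertNth {α : Type*} [MeasurableSpace α] (μ : Measure α) [SigmaFinite μ]
    {n : ℕ} (m : Fin (n + 1)) :
    MeasurePreserving (fun p : (Fin n → α) × α => (m.insertNth p.2 p.1 : Fin (n + 1) → α))
      ((Measure.pi fun _ => μ).prod μ) (Measure.pi fun _ => μ) :=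
  ((measurePreserving_piFinSuccAbove (fun _ : Fin (n + 1) => μ) m).symm).comp
    Measure.measurePreserving_swap

theorem measurePreserving_curry_swap {α ι κ : Type*} [Fintype ι] [Fintype κ] [MeasurableSpace α]
    (μ : Measure α) [SigmaFinite μ] :
    MeasurePreserving (fun (x : ι × κ → α) (j : κ) (i : ι) => x (i, j))
      (Measure.pi fun _ => μ) (Measure.pi fun _ => Measure.pi fun _ => μ) := by
  refine ⟨by fun_prop, ?_⟩
  let e : (ι × κ → α) ≃ᵐ (κ → ι → α) :=
    { toFun := fun x j i => x (i, j)
      invFun := fun y p => y p.2 p.1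
      left_inv := fun _ => rfl
      right_inv := fun _ => rfl
      measurable_toFun := by
        change Measurable fun (x : ι × κ → α) (j : κ) (i : ι) => x (i, j)
        fun_prop
      measurable_invFun := by
        change Measurable fun (y : κ → ι → α) (p : ι × κ) => y p.2 p.1
        fun_prop }
  change Measure.map e _ = _
  rw [MeasurableEquiv.map_apply_eq_iff_map_symm_apply_eq]
  refine Measure.pi_eq fun s hs => ?_
  rw [MeasurableEquiv.map_apply]
  have : e.symm ⁻¹' Set.univ.pi s = Set.univ.pi fun j => Set.univ.pi fun i => s (i, j) := by
    ext y
    simp only [Set.mem_preimage, Set.mem_univ_pi, Prod.forall]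
    exact forall_comm
  rw [this, Measure.pi_pi, Fintype.prod_prod_type_right]
  simp_rw [Measure.pi_pi]

/-- Conditioning on the first factor, by Fubini: a conditional law that does not depend on the
condition is the law itself. -/
theorem map_prod_eq_of_ae_map_eq {α β γ : Type*} [MeasurableSpace α] [MeasurableSpace β]
    [MeasurableSpace γ] (μ : Measure α) [IsProbabilityMeasure μ] (ν : Measure β) [SFinite ν]
    (ρ : Measure γ) {f : α × β → γ} (hf : Measurable f)
    (h : ∀ᵐ x ∂μ, ν.map (fun y => f (x, y)) = ρ) : (μ.prod ν).map f = ρ := by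
  ext s hs
  rw [Measure.map_apply hf hs, Measure.prod_apply (hf hs)]
  have : ∀ᵐ x ∂μ, ν (Prod.mk x ⁻¹' (f ⁻¹' s)) = ρ s := by
    filter_upwards [h] with x hx
    rw [← hx, Measure.map_apply (by fun_prop) hs]
    rfl
  rw [lintegral_congr_ae this]
  simp

/-- The complement of the span of `b` has dimension `d + 1 > 0`, and the squared norm of the
projection of `h` onto it is Gamma distributed, hence almost surely nonzero. -/
theorem ae_linearIndependent_finCons {K n d : ℕ} (hK : K = n + (d + 1)) {b : Fin n → Fin K → ℂ}
    (hb : LinearIndependent ℂ b) :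
    ∀ᵐ h ∂(Measure.pi fun _ : Fin K => complexGaussian),
      LinearIndependent ℂ (Fin.cons h b : Fin (n + 1) → Fin K → ℂ) := by
  obtain ⟨v, hv, hvb, -⟩ := exists_orthonormal_orthogonal hK hb
  have hlaw := (measurePreserving_sum_norm_sq d).comp (measurePreserving_inner_orthonormal hv)
  have h0 : ∀ᵐ x ∂(gammaMeasure ((d : ℝ) + 1) 1), x ≠ 0 :=
    (withDensity_absolutelyContinuous _ _).ae_le (Measure.ae_ne volume 0)
  have hspan : ∀ x ∈ Submodule.span ℂ (Set.range b), ∀ i, inner ℂ (v i) (WithLp.toLp 2 x) = 0 := by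
    intro x hx i
    induction hx using Submodule.span_induction with
    | mem x hx => obtain ⟨j, rfl⟩ := hx; exact hvb i j
    | zero => simp
    | add x y _ _ hx hy => rw [WithLp.toLp_add, inner_add_right, hx, hy, add_zero]
    | smul c x _ hx => rw [WithLp.toLp_smul, inner_smul_right, hx, mul_zero]
  filter_upwards [hlaw.quasiMeasurePreserving.ae h0] with h hh
  rw [linearIndependent_finCons]
  refine ⟨hb, fun hmem => hh ?_⟩
  exact Finset.sum_eq_zero fun i _ => by simp [hspan h hmem i]

theorem ae_linearIndependent {K n : ℕ} (hn : n ≤ K) :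
    ∀ᵐ a ∂(Measure.pi fun _ : Fin n => Measure.pi fun _ : Fin K => complexGaussian),
      LinearIndependent ℂ a := by
  induction n with
  | zero => exact ae_of_all _ fun _ => linearIndependent_empty_type
  | succ n ih =>
    obtain ⟨d, hd⟩ := Nat.exists_eq_add_of_le hn
    have hmp := measurePreserving_insertNth (Measure.pi fun _ : Fin K => complexGaussian)
      (0 : Fin (n + 1))
    have hms : MeasurableSet {a : Fin (n + 1) → Fin K → ℂ | LinearIndependent ℂ a} :=
      isOpen_setOfPred_linearIndependent.measurableSet
    rw [← hmp.map_eq, ae_map_iff hmp.measurable.aemeasurable hms]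
    refine (Measure.ae_prod_iff_ae_ae (hmp.measurable hms)).2 ?_
    filter_upwards [ih (by omega)] with b hb
    filter_upwards [ae_linearIndependent_finCons (d := d) (by omega) hb] with h hh
    simpa using hh

theorem measurable_zfGain_of {K M : ℕ} (m : Fin M) :
    Measurable fun a : Fin M → Fin K → ℂ => zfGain 1 (Matrix.of fun k j => a j k) m := by
  have hentry : ∀ j i, Measurable fun a : Fin M → Fin K → ℂ =>
      ((Matrix.of fun k j => a j k)ᴴ * (Matrix.of fun k j => a j k : Matrix (Fin K) (Fin M) ℂ))
        j i := by
    intro j i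
    simp only [Matrix.mul_apply, Matrix.conjTranspose_apply, Matrix.of_apply]
    have : Measurable (star : ℂ → ℂ) := continuous_star.measurable
    fun_prop
  have hinv : ∀ j i, Measurable fun a : Fin M → Fin K → ℂ =>
      ((Matrix.of fun k j => a j k)ᴴ * (Matrix.of fun k j => a j k : Matrix (Fin K) (Fin M) ℂ))⁻¹
        j i := by
    intro j i
    -- By Cramer's rule the entries are polynomials times the inverse of the determinant; singular
    -- matrices need no separate case, since inversion on `ℂ` with `0⁻¹ = 0` is measurable.
    simp only [Matrix.inv_def, Matrix.smul_apply, Ring.inverse_eq_inv', Matrix.adjugate_apply,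
      smul_eq_mul]
    refine Measurable.mul (Measurable.inv ?_) ?_
    · simp only [Matrix.det_apply]
      refine Finset.measurable_sum _ fun σ _ => Measurable.const_smul ?_ _
      exact Finset.measurable_prod _ fun k _ => hentry _ _
    · simp only [Matrix.det_apply]
      refine Finset.measurable_sum _ fun σ _ => Measurable.const_smul ?_ _
      refine Finset.measurable_prod _ fun k _ => ?_
      by_cases h : σ k = i
      · simp only [Matrix.updateRow_apply, h, if_true]
        exact measurable_const
      · simp only [Matrix.updateRow_apply, h, if_false]
        exact hentry _ _
  have hcol : Measurable fun a : Fin M → Fin K → ℂ =>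
      zfColumn 1 (Matrix.of fun k j => a j k : Matrix (Fin K) (Fin M) ℂ) m := by
    have heq : ∀ a : Fin M → Fin K → ℂ,
        zfColumn 1 (Matrix.of fun k j => a j k : Matrix (Fin K) (Fin M) ℂ) m =
        WithLp.toLp 2 fun k => ∑ j, a j k * ((Matrix.of fun k j => a j k)ᴴ *
          (Matrix.of fun k j => a j k : Matrix (Fin K) (Fin M) ℂ))⁻¹ j m := by
      intro a
      ext k
      rw [zfColumn, Matrix.mul_one]
      exact Matrix.mul_apply
    simp_rw [heq]
    refine (WithLp.measurable_toLp 2 _).comp (measurable_pi_lambda _ fun k => ?_)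
    refine Finset.measurable_sum _ fun j _ => ?_
    exact Measurable.mul (by fun_prop) (hinv j m)
  have hstar : Measurable (star : ℂ → ℂ) := continuous_star.measurable
  have hcolk : ∀ k, Measurable fun a : Fin M → Fin K → ℂ =>
      zfColumn 1 (Matrix.of fun k j => a j k : Matrix (Fin K) (Fin M) ℂ) m k := by
    intro k
    exact (measurable_pi_apply k).comp ((WithLp.measurable_ofLp 2 _).comp hcol)
  unfold zfGain zfEqualizer
  simp only [Matrix.mul_one, Matrix.of_apply, PiLp.smul_apply, smul_eq_mul]
  refine (Measurable.norm (Finset.measurable_sum _ fun k _ => ?_)).pow_const 2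
  refine Measurable.mul (hstar.comp (Measurable.mul ?_ (hcolk k))) (by fun_prop)
  exact Complex.measurable_ofReal.comp hcol.norm.inv

theorem measurePreserving_zfGain {K n d : ℕ} (hK : K = n + 1 + d) (m : Fin (n + 1)) :
    MeasurePreserving
      (fun a : Fin (n + 1) → Fin K → ℂ => zfGain 1 (Matrix.of fun k j => a j k) m)
      (Measure.pi fun _ => Measure.pi fun _ => complexGaussian)
      (gammaMeasure ((d : ℝ) + 1) 1) := by
  refine ⟨measurable_zfGain_of m, ?_⟩
  have hmp := measurePreserving_insertNth (Measure.pi fun _ : Fin K => complexGaussian) m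
  have hind := hmp.quasiMeasurePreserving.ae (ae_linearIndependent (K := K) (n := n + 1) (by omega))
  rw [← hmp.map_eq, Measure.map_map (measurable_zfGain_of m) hmp.measurable]
  refine map_prod_eq_of_ae_map_eq _ _ _ ((measurable_zfGain_of m).comp hmp.measurable) ?_
  filter_upwards [Measure.ae_ae_of_ae_prod hind] with b hb
  have hbind : LinearIndependent ℂ b := by
    -- One completion of `b` to an independent family is enough, and an almost sure event of a
    -- probability measure is nonempty.
    obtain ⟨h, hh⟩ := hb.exists
    have := hh.comp m.succAbove Fin.succAbove_right_injective
    convert this using 1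
    ext j
    simp
  obtain ⟨v, hv, hvb, hspan⟩ := exists_orthonormal_orthogonal (d := d + 1) (by omega) hbind
  have hlaw := (measurePreserving_sum_norm_sq d).comp (measurePreserving_inner_orthonormal hv)
  rw [← hlaw.map_eq]
  refine Measure.map_congr ?_
  filter_upwards [hb] with h hh
  have := zfGain_eq_sum_norm_sq m hh hv (by simpa using hvb) (by simpa using hspan)
  simpa using this

theorem IsRayleigh.hasLaw_mul_unitary {Ω : Type*} [MeasurableSpace Ω] {Pr : Measure Ω} {K M : ℕ}
    {H : Ω → Matrix (Fin K) (Fin M) ℂ} (hH : IsRayleigh Pr H) {U : Matrix (Fin M) (Fin M) ℂ}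
    (hU : U ∈ Matrix.unitaryGroup (Fin M) ℂ) :
    HasLaw (fun ω (j : Fin M) (k : Fin K) => (H ω * U) k j)
      (Measure.pi fun _ => Measure.pi fun _ => complexGaussian) Pr := by
  have h1 := hH.indep.hasLaw_pi fun ij : Fin K × Fin M => hH.hasLaw ij.1 ij.2
  -- Seen on the vectorized matrix, right multiplication by `U` pairs it with this orthonormal
  -- family; the `star` cancels the conjugation in the first argument of `inner`.
  let v : Fin K × Fin M → EuclideanSpace ℂ (Fin K × Fin M) := fun p =>
    WithLp.toLp 2 fun x => if x.1 = p.1 then star (U x.2 p.2) else 0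
  have hv : Orthonormal ℂ v := by
    rw [orthonormal_iff_ite]
    rintro ⟨k, m⟩ ⟨k', m'⟩
    have hUU : (Uᴴ * U) m' m = (1 : Matrix (Fin M) (Fin M) ℂ) m' m := by
      rw [← Matrix.star_eq_conjTranspose, Matrix.mem_unitaryGroup_iff'.1 hU]
    rw [Matrix.mul_apply, Matrix.one_apply] at hUU
    rw [PiLp.inner_apply, Fintype.sum_prod_type]
    simp only [v, RCLike.inner_apply, Prod.mk.injEq]
    by_cases hk : k = k'
    · subst hk
      simp only [true_and]
      rw [Finset.sum_eq_single k (fun i _ hi => by simp [hi]) (by simp)]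
      simpa [eq_comm] using hUU
    · rw [if_neg (by tauto)]
      refine Finset.sum_eq_zero fun i _ => Finset.sum_eq_zero fun j _ => ?_
      by_cases hi : i = k
      · simp [hi, hk]
      · simp [hi]
  have h2 := (measurePreserving_curry_swap complexGaussian).comp_hasLaw
    ((measurePreserving_inner_orthonormal hv).comp_hasLaw h1)
  convert h2 using 1
  ext ω j k
  simp only [Function.comp, Matrix.mul_apply, PiLp.inner_apply, Fintype.sum_prod_type, v,
    RCLike.inner_apply]
  rw [Finset.sum_eq_single k (fun i _ hi => by simp [hi]) (by simp)]
  simp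

theorem IsRayleigh.hasLaw_zfGain {Ω : Type*} [MeasurableSpace Ω] {Pr : Measure Ω} {K M : ℕ}
    (hMK : M ≤ K) {H : Ω → Matrix (Fin K) (Fin M) ℂ} (hH : IsRayleigh Pr H)
    {U : Matrix (Fin M) (Fin M) ℂ} (hU : U ∈ Matrix.unitaryGroup (Fin M) ℂ) (m : Fin M) :
    HasLaw (fun ω => zfGain U (H ω) m) (gammaMeasure (((K - M : ℕ) : ℝ) + 1) 1) Pr := by
  obtain ⟨n, rfl⟩ : ∃ n, M = n + 1 := ⟨M - 1, by have := m.pos; omega⟩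
  have := (measurePreserving_zfGain (K := K) (d := K - (n + 1)) (by omega) m).comp_hasLaw
    (hH.hasLaw_mul_unitary hU)
  simp_rw [zfGain_mul_one U]
  exact this

/-! ### Logarithmic integrals against the Gamma law -/

theorem gammaPDF_toReal_smul_nat (n : ℕ) (f : ℝ → ℝ) (x : ℝ) :
    (gammaPDF ((n : ℝ) + 1) 1 x).toReal • f x =
      (Set.Ici (0 : ℝ)).indicator (fun x => f x * (x ^ n * Real.exp (-x) / n !)) x := by
  rw [gammaPDF, ENNReal.toReal_ofReal (gammaPDFReal_nonneg (by positivity) one_pos x), gammaPDFReal]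
  by_cases hx : 0 ≤ x
  · rw [Set.indicator_of_mem (show x ∈ Set.Ici 0 from hx), if_pos hx, Real.Gamma_nat_eq_factorial]
    simp only [add_sub_cancel_right, Real.one_rpow, Real.rpow_natCast, smul_eq_mul, one_mul]
    ring
  · rw [Set.indicator_of_notMem (by simpa using hx), if_neg hx, zero_smul]

theorem integral_gammaMeasure_nat (n : ℕ) (f : ℝ → ℝ) :
    ∫ x, f x ∂(gammaMeasure ((n : ℝ) + 1) 1) =
      ∫ x in Set.Ioi 0, f x * (x ^ n * Real.exp (-x) / n !) := by
  rw [gammaMeasure, integral_withDensity_eq_integral_toReal_smul₀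
      (f := gammaPDF ((n : ℝ) + 1) 1) (measurable_gammaPDFReal _ _).ennreal_ofReal.aemeasurable
      (ae_of_all _ fun _ => ENNReal.ofReal_lt_top)]
  simp_rw [gammaPDF_toReal_smul_nat]
  rw [integral_indicator measurableSet_Ici, integral_Ici_eq_integral_Ioi]

theorem integrable_gammaMeasure_nat_iff (n : ℕ) (f : ℝ → ℝ) :
    Integrable f (gammaMeasure ((n : ℝ) + 1) 1) ↔
      IntegrableOn (fun x => f x * (x ^ n * Real.exp (-x) / n !)) (Set.Ioi 0) := by
  rw [gammaMeasure, integrable_withDensity_iff_integrable_smul'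
      (f := gammaPDF ((n : ℝ) + 1) 1) (measurable_gammaPDFReal _ _).ennreal_ofReal
      (ae_of_all _ fun _ => ENNReal.ofReal_lt_top)]
  simp_rw [gammaPDF_toReal_smul_nat]
  rw [integrable_indicator_iff measurableSet_Ici, integrableOn_Ici_iff_integrableOn_Ioi]

theorem ae_pos_gammaMeasure_nat (n : ℕ) : ∀ᵐ x ∂(gammaMeasure ((n : ℝ) + 1) 1), 0 < x := by
  rw [gammaMeasure, ae_withDensity_iff (f := gammaPDF ((n : ℝ) + 1) 1)
    (measurable_gammaPDFReal _ _).ennreal_ofReal]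
  filter_upwards [Measure.ae_ne volume 0] with x hx h
  by_contra hneg
  exact h (gammaPDF_of_neg (lt_of_le_of_ne (not_lt.1 hneg) hx))

theorem integrableOn_pow_mul_exp_neg (n : ℕ) :
    IntegrableOn (fun x : ℝ => x ^ n * Real.exp (-x)) (Set.Ioi 0) := by
  simpa using integrableOn_pow_mul_exp_neg_mul n one_pos

theorem integral_pow_mul_exp_neg (n : ℕ) :
    ∫ x in Set.Ioi (0 : ℝ), x ^ n * Real.exp (-x) = n ! := by
  rw [← Real.Gamma_nat_eq_factorial, Real.Gamma_eq_integral (by positivity)]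
  refine setIntegral_congr_fun measurableSet_Ioi fun x _ => ?_
  simp [mul_comm]

theorem integrableOn_pow_mul_exp_neg_div {a : ℝ} (ha : 0 < a) (k : ℕ) :
    IntegrableOn (fun x : ℝ => x ^ k * Real.exp (-x) / (x + a)) (Set.Ioi 0) := by
  refine ((integrableOn_pow_mul_exp_neg k).div_const a).mono'
    (Measurable.aestronglyMeasurable (by fun_prop)) ?_
  refine (ae_restrict_iff' measurableSet_Ioi).2 (ae_of_all _ fun x (hx : 0 < x) => ?_)
  rw [Real.norm_of_nonneg (by positivity)]
  gcongr
  linarith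

theorem integral_exp_neg_div {a : ℝ} :
    ∫ x in Set.Ioi (0 : ℝ), Real.exp (-x) / (x + a) = -(Real.exp a * expIntegralEi (-a)) := by
  have h := (measurePreserving_add_right volume a).setIntegral_preimage_emb
    (measurableEmbedding_addRight a) (fun t => Real.exp (-t) / t) (Set.Ioi a)
  have hpre : (fun x : ℝ => x + a) ⁻¹' Set.Ioi a = Set.Ioi 0 := by
    ext x
    simp
  rw [hpre] at h
  rw [expIntegralEi, neg_neg, mul_neg, neg_neg, ← h, ← integral_const_mul]
  refine setIntegral_congr_fun measurableSet_Ioi fun x _ => ?_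
  rw [← mul_div_assoc, ← Real.exp_add]
  congr 2
  ring

/-- Recursion from `x^{k+1} / (x + a) = x^k - a x^k / (x + a)`: each step adds `k!`, the newest term
of the finite sum. -/
theorem integral_pow_mul_exp_neg_div {a : ℝ} (ha : 0 < a) (k : ℕ) :
    ∫ x in Set.Ioi (0 : ℝ), x ^ k * Real.exp (-x) / (x + a) =
      (-a) ^ k * (-(Real.exp a * expIntegralEi (-a)) +
        ∑ i ∈ Finset.Icc 1 k, ((i - 1)! : ℝ) * (-a) ^ (-(i : ℤ))) := by
  induction k with
  | zero => simp [integral_exp_neg_div]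
  | succ k ih =>
    have h : ∀ x ∈ Set.Ioi (0 : ℝ), x ^ (k + 1) * Real.exp (-x) / (x + a) =
        x ^ k * Real.exp (-x) - a * (x ^ k * Real.exp (-x) / (x + a)) := by
      intro x hx
      have : x + a ≠ 0 := (add_pos hx ha).ne'
      field_simp
      ring
    rw [setIntegral_congr_fun measurableSet_Ioi h, integral_sub (integrableOn_pow_mul_exp_neg k)
      ((integrableOn_pow_mul_exp_neg_div ha k).const_mul a), integral_const_mul, ih,
      integral_pow_mul_exp_neg, Finset.sum_Icc_succ_top (by omega)]
    have hpow : (-a) ^ (k + 1) * (-a) ^ (-((k + 1 : ℕ) : ℤ)) = 1 := by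
      rw [_root_.zpow_neg, zpow_natCast]
      exact mul_inv_cancel₀ (pow_ne_zero _ (neg_ne_zero.2 ha.ne'))
    rw [← add_assoc, mul_add ((-a) ^ (k + 1)), Nat.add_sub_cancel, mul_left_comm _ (k ! : ℝ), hpow]
    ring

/-- The function is the tail of the Gamma law of shape `n + 1`; its derivative telescopes to minus
the density. -/
theorem hasDerivAt_exp_neg_mul_sum (n : ℕ) (x : ℝ) :
    HasDerivAt (fun y => Real.exp (-y) * ∑ k ∈ Finset.range (n + 1), y ^ k / k !)
      (-(x ^ n * Real.exp (-x) / n !)) x := by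
  induction n with
  | zero => simpa using (hasDerivAt_id x).neg.exp
  | succ n ih =>
    have h := ih.add ((hasDerivAt_id x).neg.exp.mul
      ((hasDerivAt_pow (n + 1) x).div_const ((n + 1)! : ℝ)))
    refine (h.congr_deriv ?_).congr_of_eventuallyEq (Eventually.of_forall fun y => ?_)
    · simp [Nat.factorial_succ]
      field_simp
      ring
    · simp only [Finset.sum_range_succ _ (n + 1), Pi.add_apply, Pi.mul_apply, Pi.neg_apply, id]
      ring

theorem integrable_id_gammaMeasure_nat (n : ℕ) :
    Integrable (fun x => x) (gammaMeasure ((n : ℝ) + 1) 1) := by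
  rw [integrable_gammaMeasure_nat_iff]
  have h : IntegrableOn (fun x : ℝ => x ^ (n + 1) * Real.exp (-x) / n !) (Set.Ioi 0) :=
    (integrableOn_pow_mul_exp_neg (n + 1)).div_const (n ! : ℝ)
  refine h.congr_fun (fun x _ => ?_) measurableSet_Ioi
  ring

theorem integrable_log_one_add_gammaMeasure_nat (n : ℕ) {s : ℝ} (hs : 0 ≤ s) :
    Integrable (fun x => Real.log (1 + s * x)) (gammaMeasure ((n : ℝ) + 1) 1) := by
  refine ((integrable_id_gammaMeasure_nat n).const_mul s).mono'
    (Measurable.aestronglyMeasurable (by fun_prop)) ?_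
  filter_upwards [ae_pos_gammaMeasure_nat n] with x hx
  have h0 : 0 ≤ s * x := by positivity
  rw [Real.norm_of_nonneg (Real.log_nonneg (by linarith))]
  linarith [Real.log_le_sub_one_of_pos (show 0 < 1 + s * x by linarith)]

theorem integral_log_one_add_gammaMeasure_nat (n : ℕ) {s : ℝ} (hs : 0 < s) :
    ∫ x, Real.log (1 + s * x) ∂(gammaMeasure ((n : ℝ) + 1) 1) =
      ∑ k ∈ Finset.range (n + 1), (∫ x in Set.Ioi (0 : ℝ),
        x ^ k * Real.exp (-x) / (x + 1 / s)) / k ! := by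
  have ha : 0 < 1 / s := by positivity
  have hI := (integrable_gammaMeasure_nat_iff n _).1 (integrable_log_one_add_gammaMeasure_nat n hs.le)
  have hT : ∀ k ∈ Finset.range (n + 1), IntegrableOn
      (fun x => x ^ k * Real.exp (-x) / (x + 1 / s) / k !) (Set.Ioi 0) := fun k _ =>
    (integrableOn_pow_mul_exp_neg_div ha k).div_const _
  -- Boundary term of the integration by parts. It vanishes at `0` since `log 1 = 0`, and at
  -- infinity since `log (1 + s x) ≤ s x`.
  set F : ℝ → ℝ := fun x => Real.log (1 + s * x) *
    (Real.exp (-x) * ∑ k ∈ Finset.range (n + 1), x ^ k / k !) with hF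
  have hd : ∀ x ∈ Set.Ioi (0 : ℝ), HasDerivAt F
      ((∑ k ∈ Finset.range (n + 1), x ^ k * Real.exp (-x) / (x + 1 / s) / (k ! : ℝ)) -
        Real.log (1 + s * x) * (x ^ n * Real.exp (-x) / n !)) x := by
    intro x hx
    have hx0 : (0 : ℝ) < x := hx
    have hpos : 0 < 1 + s * x := by positivity
    have h1 : HasDerivAt (fun x => Real.log (1 + s * x)) (s / (1 + s * x)) x := by
      have := (((hasDerivAt_id x).const_mul s).const_add 1).log hpos.ne'
      simpa using this
    refine (h1.mul (hasDerivAt_exp_neg_mul_sum n x)).congr_deriv ?_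
    rw [mul_neg, ← sub_eq_add_neg]
    congr 1
    rw [← mul_assoc, Finset.mul_sum]
    refine Finset.sum_congr rfl fun k _ => ?_
    have : x + 1 / s ≠ 0 := (add_pos hx0 ha).ne'
    field_simp
    ring
  have hcont : ContinuousWithinAt F (Set.Ici 0) 0 := by
    refine ContinuousAt.continuousWithinAt ?_
    exact (ContinuousAt.log (by fun_prop) (by simp)).mul (by fun_prop)
  have hlim : Tendsto F atTop (𝓝 0) := by
    have hub : Tendsto (fun x : ℝ => ∑ k ∈ Finset.range (n + 1),
        s / k ! * (x ^ (k + 1) * Real.exp (-x))) atTop (𝓝 0) := by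
      rw [show (0 : ℝ) = ∑ k ∈ Finset.range (n + 1), s / k ! * 0 by simp]
      exact tendsto_finsetSum _ fun k _ =>
        (Real.tendsto_pow_mul_exp_neg_atTop_nhds_zero (k + 1)).const_mul _
    refine tendsto_of_tendsto_of_tendsto_of_le_of_le' tendsto_const_nhds hub ?_ ?_
    · filter_upwards [eventually_ge_atTop 0] with x hx
      have h0 : 0 ≤ s * x := by positivity
      have := Real.log_nonneg (show 1 ≤ 1 + s * x by linarith)
      positivity
    · filter_upwards [eventually_ge_atTop 0] with x hx
      have h0 : 0 ≤ s * x := by positivity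
      have hl := Real.log_le_sub_one_of_pos (show 0 < 1 + s * x by linarith)
      calc F x ≤ (s * x) * (Real.exp (-x) * ∑ k ∈ Finset.range (n + 1), x ^ k / k !) := by
            simp only [hF]
            gcongr
            linarith
        _ = _ := by
            rw [← mul_assoc, Finset.mul_sum]
            refine Finset.sum_congr rfl fun k _ => ?_
            ring
  have key := integral_Ioi_of_hasDerivAt_of_tendsto hcont hd
    ((integrable_finsetSum _ hT).sub hI) hlim
  rw [integral_sub (integrable_finsetSum _ hT) hI, integral_finsetSum _ hT] at key
  simp only [hF, mul_zero, add_zero, Real.log_one, zero_mul, sub_zero] at key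
  rw [integral_gammaMeasure_nat, ← sub_eq_zero.1 key]
  simp_rw [integral_div]

theorem integral_logb_one_add_gammaMeasure_nat (n : ℕ) {s : ℝ} (hs : 0 < s) :
    ∫ x, Real.logb 2 (1 + s * x) ∂(gammaMeasure ((n : ℝ) + 1) 1) =
      ∑ μ ∈ Finset.range (n + 1),
        (-1 / s) ^ (n - μ) / (((n - μ)! : ℝ) * Real.log 2) *
        (-(Real.exp (1 / s) * expIntegralEi (-1 / s)) +
          ∑ i ∈ Finset.Icc 1 (n - μ), ((i - 1)! : ℝ) * (-1 / s) ^ (-(i : ℤ))) := by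
  simp_rw [Real.logb, neg_div]
  -- The closed form indexes the powers backwards, `k = n - μ`.
  rw [integral_div, integral_log_one_add_gammaMeasure_nat n hs, Finset.sum_div,
    ← Finset.sum_range_reflect]
  refine Finset.sum_congr rfl fun μ _ => ?_
  rw [show n + 1 - 1 - μ = n - μ by omega, integral_pow_mul_exp_neg_div (by positivity)]
  ring

theorem integrable_log_gammaMeasure_nat (n : ℕ) :
    Integrable (fun x => Real.log x) (gammaMeasure ((n : ℝ) + 1) 1) := by
  rw [integrable_gammaMeasure_nat_iff, ← Set.Ioc_union_Ioi_eq_Ioi zero_le_one]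
  refine IntegrableOn.union ?_ ?_
  · have hlog : IntegrableOn Real.log (Set.Ioc 0 1) :=
      (intervalIntegrable_iff_integrableOn_Ioc_of_le zero_le_one).1
        intervalIntegral.intervalIntegrable_log'
    refine hlog.norm.mono' (by fun_prop) ?_
    refine (ae_restrict_iff' measurableSet_Ioc).2 (ae_of_all _ fun x hx => ?_)
    have h0 : 0 ≤ x := hx.1.le
    rw [norm_mul]
    refine mul_le_of_le_one_right (norm_nonneg _) ?_
    rw [Real.norm_of_nonneg (by positivity)]
    refine div_le_one_of_le₀ ?_ (by positivity)
    have h1 : x ^ n ≤ 1 := pow_le_one₀ h0 hx.2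
    have h2 : Real.exp (-x) ≤ 1 := Real.exp_le_one_iff.2 (by linarith)
    have h3 : (1 : ℝ) ≤ n ! := by exact_mod_cast n.factorial_pos
    have := Real.exp_pos (-x)
    nlinarith
  · have h := ((integrable_gammaMeasure_nat_iff n _).1 (integrable_id_gammaMeasure_nat n)).mono_set
      (Set.Ioi_subset_Ioi zero_le_one)
    refine h.mono' (by fun_prop) ?_
    refine (ae_restrict_iff' measurableSet_Ioi).2 (ae_of_all _ fun x (hx : 1 < x) => ?_)
    have hx0 : 0 < x := by linarith
    have hl := Real.log_nonneg hx.le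
    rw [Real.norm_of_nonneg (by positivity)]
    gcongr
    linarith [Real.log_le_sub_one_of_pos hx0]

/-- Differentiating Euler's integral under the integral sign gives `Γ'`, and `ψ = Γ' / Γ` with `Γ(n
+ 1) = n!`. The derivative is taken on `ℂ` and restricted to the real line. -/
theorem integral_log_gammaMeasure_nat (n : ℕ) :
    ∫ x, Real.log x ∂(gammaMeasure ((n : ℝ) + 1) 1) = realDigamma ((n : ℝ) + 1) := by
  have hpos : (0 : ℝ) < (n : ℝ) + 1 := by positivity
  have hC : HasDerivAt Complex.Gamma (∫ t : ℝ in Set.Ioi 0, (t : ℂ) ^ ((((n : ℝ) + 1 : ℝ) : ℂ) - 1) *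
      (Real.log t * Real.exp (-t))) (((n : ℝ) + 1 : ℝ) : ℂ) := by
    refine (Complex.hasDerivAt_GammaIntegral (by simpa using hpos)).congr_of_eventuallyEq ?_
    have hopen : IsOpen {s : ℂ | 0 < s.re} := isOpen_lt continuous_const Complex.continuous_re
    filter_upwards [hopen.mem_nhds (show 0 < ((((n : ℝ) + 1 : ℝ) : ℂ)).re by simpa using hpos)]
      with s hs
    exact Complex.Gamma_eq_integral hs
  have hI : ∫ t : ℝ in Set.Ioi 0, (t : ℂ) ^ ((((n : ℝ) + 1 : ℝ) : ℂ) - 1) *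
      (Real.log t * Real.exp (-t)) =
      ((∫ t : ℝ in Set.Ioi 0, Real.log t * (t ^ n * Real.exp (-t)) : ℝ) : ℂ) := by
    rw [← integral_complex_ofReal]
    refine setIntegral_congr_fun measurableSet_Ioi fun t _ => ?_
    simp only [Complex.ofReal_add, Complex.ofReal_one, add_sub_cancel_right]
    push_cast
    rw [Complex.cpow_natCast]
    ring
  rw [hI] at hC
  have hR : HasDerivAt Real.Gamma (∫ t : ℝ in Set.Ioi 0, Real.log t * (t ^ n * Real.exp (-t)))
      ((n : ℝ) + 1) := hC.real_of_complex
  rw [realDigamma, (hR.log (Real.Gamma_pos_of_pos hpos).ne').deriv, Real.Gamma_nat_eq_factorial,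
    integral_gammaMeasure_nat, ← integral_div]
  simp_rw [mul_div_assoc]

theorem tendsto_integral_log_add_gammaMeasure_nat (n : ℕ) :
    Tendsto (fun a => ∫ x, Real.log (a + x) ∂(gammaMeasure ((n : ℝ) + 1) 1)) (𝓝[>] 0)
      (𝓝 (realDigamma ((n : ℝ) + 1))) := by
  rw [← integral_log_gammaMeasure_nat]
  -- For `0 < a < 1`, `log x ≤ log (a + x) ≤ a + x - 1 ≤ x`.
  refine tendsto_integral_filter_of_dominated_convergence (fun x => |Real.log x| + x)
    (Eventually.of_forall fun a => Measurable.aestronglyMeasurable (by fun_prop)) ?_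
    ((integrable_log_gammaMeasure_nat n).abs.add (integrable_id_gammaMeasure_nat n)) ?_
  · filter_upwards [Ioo_mem_nhdsGT zero_lt_one] with a ha
    filter_upwards [ae_pos_gammaMeasure_nat n] with x hx
    have h1 : Real.log x ≤ Real.log (a + x) := Real.log_le_log hx (by linarith [ha.1])
    have h2 := Real.log_le_sub_one_of_pos (show 0 < a + x by linarith [ha.1])
    rw [Real.norm_eq_abs, abs_le]
    have h3 := neg_abs_le (Real.log x)
    have h4 := abs_nonneg (Real.log x)
    constructor <;> linarith [ha.2]
  · filter_upwards [ae_pos_gammaMeasure_nat n] with x hx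
    have : ContinuousAt (fun a => Real.log (a + x)) 0 :=
      ContinuousAt.log (by fun_prop) (by simpa using hx.ne')
    simpa using this.tendsto.mono_left nhdsWithin_le_nhds

theorem tendsto_integral_logb_one_add_sub_logb (n : ℕ) :
    Tendsto (fun s => ∫ x, Real.logb 2 (1 + s * x) ∂(gammaMeasure ((n : ℝ) + 1) 1) - Real.logb 2 s)
      atTop (𝓝 (realDigamma ((n : ℝ) + 1) / Real.log 2)) := by
  have h := ((tendsto_integral_log_add_gammaMeasure_nat n).comp
    tendsto_inv_atTop_nhdsGT_zero).div_const (Real.log 2)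
  refine h.congr' ?_
  filter_upwards [eventually_gt_atTop 0] with s hs
  have := isProbabilityMeasure_gammaMeasure (a := (n : ℝ) + 1) (by positivity) one_pos
  simp only [Function.comp, Real.logb]
  rw [integral_div, ← sub_div]
  congr 1
  have hae : ∀ᵐ x ∂(gammaMeasure ((n : ℝ) + 1) 1),
      Real.log (s⁻¹ + x) = Real.log (1 + s * x) - Real.log s := by
    filter_upwards [ae_pos_gammaMeasure_nat n] with x hx
    rw [← Real.log_div (by positivity) hs.ne']
    congr 1
    field_simp
  rw [integral_congr_ae hae, integral_sub (integrable_log_one_add_gammaMeasure_nat n hs.le)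
    (integrable_const _)]
  simp

/-! ### Optimality of water-filling for sensing -/

theorem Matrix.PosDef.log_det_re_le_trace_sub_card {n : Type*} [Fintype n] [DecidableEq n]
    {Z : Matrix n n ℂ} (hZ : Z.PosDef) :
    Real.log Z.det.re ≤ Z.trace.re - Fintype.card n := by
  have hdet : Z.det.re = ∏ i, hZ.isHermitian.eigenvalues i := by
    rw [hZ.isHermitian.det_eq_prod_eigenvalues, ← Complex.ofReal_re (∏ i, _)]
    push_cast
    rfl
  have htr : Z.trace.re = ∑ i, hZ.isHermitian.eigenvalues i := by
    rw [hZ.isHermitian.trace_eq_sum_eigenvalues, ← Complex.ofReal_re (∑ i, _)]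
    push_cast
    rfl
  rw [hdet, htr, Real.log_prod fun i _ => (hZ.eigenvalues_pos i).ne']
  calc ∑ i, Real.log (hZ.isHermitian.eigenvalues i)
      ≤ ∑ i, (hZ.isHermitian.eigenvalues i - 1) :=
        Finset.sum_le_sum fun i _ => Real.log_le_sub_one_of_pos (hZ.eigenvalues_pos i)
    _ = _ := by simp [Finset.sum_sub_distrib]

/-- Tangent plane of the concave function `log det` at `diag(d)`: rescale by `D = diag(d)^{-1/2}`
and apply the bound at the identity to `D Y D`. -/
theorem Matrix.PosDef.log_det_re_le_sum {n : Type*} [Fintype n] [DecidableEq n]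
    {Y : Matrix n n ℂ} (hY : Y.PosDef) {d : n → ℝ} (hd : ∀ i, 0 < d i) :
    Real.log Y.det.re ≤ ∑ i, Real.log (d i) + ∑ i, ((Y i i).re / d i - 1) := by
  set D : Matrix n n ℂ := Matrix.diagonal fun i => (((√(d i))⁻¹ : ℝ) : ℂ) with hD
  have hDH : Dᴴ = D := by
    rw [hD, Matrix.diagonal_conjTranspose]
    congr 1
    ext i
    simp
  have hsq : ∀ i, (√(d i))⁻¹ * (√(d i))⁻¹ = (d i)⁻¹ := fun i => by
    rw [← mul_inv, Real.mul_self_sqrt (hd i).le]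
  have hprod : (0 : ℝ) < ∏ i, d i := Finset.prod_pos fun i _ => hd i
  have hDdet : D.det * D.det = (((∏ i, d i)⁻¹ : ℝ) : ℂ) := by
    rw [hD, Matrix.det_diagonal, ← Finset.prod_mul_distrib, ← Finset.prod_inv_distrib]
    push_cast
    refine Finset.prod_congr rfl fun i _ => ?_
    exact_mod_cast hsq i
  have hinj : Function.Injective D.mulVec := by
    refine Matrix.mulVec_injective_of_isUnit ?_
    rw [Matrix.isUnit_iff_isUnit_det, isUnit_iff_ne_zero]
    intro h0
    rw [h0, zero_mul] at hDdet
    exact (inv_pos.2 hprod).ne (by exact_mod_cast hDdet)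
  have hZ : (D * Y * D).PosDef := by
    have := hY.conjTranspose_mul_mul_same hinj
    rwa [hDH] at this
  have h := hZ.log_det_re_le_trace_sub_card
  have hdet : (D * Y * D).det.re = (∏ i, d i)⁻¹ * Y.det.re := by
    rw [Matrix.det_mul, Matrix.det_mul, mul_right_comm, hDdet, Complex.re_ofReal_mul]
  have htr : (D * Y * D).trace.re = ∑ i, (Y i i).re / d i := by
    rw [Matrix.trace, Complex.re_sum]
    refine Finset.sum_congr rfl fun i _ => ?_
    rw [Matrix.diag_apply, hD, Matrix.mul_diagonal, Matrix.diagonal_mul, mul_right_comm,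
      ← Complex.ofReal_mul, hsq, Complex.re_ofReal_mul]
    ring
  have hYpos : 0 < Y.det.re := (Complex.pos_iff.1 hY.det_pos).1
  rw [hdet, htr, Real.log_mul (inv_pos.2 hprod).ne' hYpos.ne', Real.log_inv,
    Real.log_prod fun i _ => (hd i).ne'] at h
  rw [Finset.sum_sub_distrib, Finset.sum_const, Finset.card_univ, nsmul_eq_mul, mul_one]
  linarith

theorem waterFill_nonneg {M : ℕ} (L : ℕ) (lam : Fin M → ℝ) (ν : ℝ) (m : Fin M) :
    0 ≤ waterFill L lam ν m := le_max_left _ _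

/-- KKT conditions: the marginal rate equals `ν` on an active channel and is at most `ν` on an
inactive one, where `q - 0` is nonnegative. -/
theorem waterFill_slope_mul_le {M L : ℕ} (hL : 0 < L) {lam : Fin M → ℝ} {ν : ℝ} (hν : 0 < ν)
    {m : Fin M} (hlam : 0 < lam m) {q : ℝ} (hq : 0 ≤ q) :
    L * lam m / (1 + L * lam m * waterFill L lam ν m) * (q - waterFill L lam ν m) ≤
      ν * (q - waterFill L lam ν m) := by
  have hL' : (0 : ℝ) < L := by exact_mod_cast hL
  have hx : 0 < L * lam m := by positivity
  unfold waterFill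
  generalize (L : ℝ) * lam m = x at hx
  rcases le_total (1 / ν - 1 / x) 0 with h | h
  · rw [max_eq_left h]
    have : x ≤ ν := (one_div_le_one_div hν hx).1 (by linarith)
    simpa using mul_le_mul_of_nonneg_right this hq
  · rw [max_eq_right h]
    have : x / (1 + x * (1 / ν - 1 / x)) = ν := by
      have : 1 + x * (1 / ν - 1 / x) = x / ν := by
        field_simp
        ring
      rw [this]
      field_simp
    rw [this]

theorem eigenvalue_pos_of_posDef {M : ℕ} {R U : Matrix (Fin M) (Fin M) ℂ} {lam : Fin M → ℝ}
    (hR : R.PosDef) (hU : U ∈ Matrix.unitaryGroup (Fin M) ℂ)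
    (hRU : R = U * Matrix.diagonal (fun m => (lam m : ℂ)) * Uᴴ) (m : Fin M) : 0 < lam m := by
  have hUU : Uᴴ * U = 1 := Matrix.mem_unitaryGroup_iff'.1 hU
  have hinj : Function.Injective U.mulVec :=
    Matrix.mulVec_injective_of_isUnit (IsUnit.of_mul_eq_one_right _ hUU)
  have h := hR.conjTranspose_mul_mul_same hinj
  have heq : Uᴴ * R * U = Matrix.diagonal (fun m => (lam m : ℂ)) := by
    rw [hRU, ← Matrix.mul_assoc, ← Matrix.mul_assoc, hUU, Matrix.one_mul, Matrix.mul_assoc, hUU,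
      Matrix.mul_one]
  rw [heq, Matrix.posDef_diagonal_iff] at h
  exact_mod_cast h m

theorem trace_mul_conjTranspose_re_eq {M : ℕ} (A : Matrix (Fin M) (Fin M) ℂ) :
    (A * Aᴴ).trace.re = ∑ m, ∑ j, ‖A m j‖ ^ 2 := by
  rw [Matrix.trace, Complex.re_sum]
  refine Finset.sum_congr rfl fun m _ => ?_
  rw [Matrix.diag_apply, Matrix.mul_apply, Complex.re_sum]
  refine Finset.sum_congr rfl fun j _ => ?_
  rw [Matrix.conjTranspose_apply, ← Complex.normSq_eq_norm_sq]
  change (A m j * (starRingEnd ℂ) (A m j)).re = _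
  rw [Complex.mul_conj, Complex.ofReal_re]

theorem trace_conjTranspose_unitary_mul {M : ℕ} {U : Matrix (Fin M) (Fin M) ℂ}
    (hU : U ∈ Matrix.unitaryGroup (Fin M) ℂ) (W : Matrix (Fin M) (Fin M) ℂ) :
    ((Uᴴ * W) * (Uᴴ * W)ᴴ).trace = (W * Wᴴ).trace := by
  have hUU : U * Uᴴ = 1 := Matrix.mem_unitaryGroup_iff.1 hU
  rw [Matrix.conjTranspose_mul, Matrix.conjTranspose_conjTranspose, Matrix.mul_assoc,
    Matrix.trace_mul_comm, ← Matrix.mul_assoc, Matrix.mul_assoc (W * Wᴴ), hUU, Matrix.mul_one]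

/-- The positive definite matrix `I + L Λ^{1/2} B Bᴴ Λ^{1/2}`, with `B = Uᴴ W`, whose determinant
is the sensing determinant of the precoder `W`. -/
noncomputable def sensingGram {M : ℕ} (L : ℕ) (lam : Fin M → ℝ) (B : Matrix (Fin M) (Fin M) ℂ) :
    Matrix (Fin M) (Fin M) ℂ :=
  1 + (L : ℂ) • ((Matrix.diagonal (fun m => ((√(lam m) : ℝ) : ℂ)) * B) *
    (Matrix.diagonal (fun m => ((√(lam m) : ℝ) : ℂ)) * B)ᴴ)

/-- Sylvester's identity `det (1 + XY) = det (1 + YX)` turns the Gram matrix around, so that the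
diagonal entries involve only the row powers of `Uᴴ W`, which add up to the power of `W`. -/
theorem sensingObjective_eq_sensingGram {M : ℕ} (L : ℕ) {R U : Matrix (Fin M) (Fin M) ℂ}
    {lam : Fin M → ℝ} (hlam : ∀ m, 0 < lam m)
    (hRU : R = U * Matrix.diagonal (fun m => (lam m : ℂ)) * Uᴴ) (W : Matrix (Fin M) (Fin M) ℂ) :
    sensingObjective L R W = Real.logb 2 (sensingGram L lam (Uᴴ * W)).det.re := by
  rw [sensingObjective, sensingGram]
  set D : Matrix (Fin M) (Fin M) ℂ := Matrix.diagonal (fun m => ((√(lam m) : ℝ) : ℂ)) with hD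
  have hDD : Dᴴ * D = Matrix.diagonal (fun m => (lam m : ℂ)) := by
    rw [hD, Matrix.diagonal_conjTranspose, Matrix.diagonal_mul_diagonal]
    congr 1
    ext m
    simp only [Pi.star_apply, Complex.star_def, Complex.conj_ofReal, ← Complex.ofReal_mul,
      Real.mul_self_sqrt (hlam m).le]
  have h1 : Wᴴ * R * W = (D * (Uᴴ * W))ᴴ * (D * (Uᴴ * W)) := by
    rw [hRU, ← hDD]
    simp only [Matrix.conjTranspose_mul, Matrix.conjTranspose_conjTranspose, Matrix.mul_assoc]
  rw [h1, ← Matrix.smul_mul, Matrix.det_one_add_mul_comm, Matrix.mul_smul]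

theorem sensingGram_posDef {M : ℕ} (L : ℕ) (lam : Fin M → ℝ) (B : Matrix (Fin M) (Fin M) ℂ) :
    (sensingGram L lam B).PosDef :=
  Matrix.PosDef.one.add_posSemidef
    ((Matrix.posSemidef_self_mul_conjTranspose _).smul (by exact_mod_cast L.zero_le))

theorem sensingGram_apply_self_re {M : ℕ} (L : ℕ) {lam : Fin M → ℝ} (hlam : ∀ m, 0 < lam m)
    (B : Matrix (Fin M) (Fin M) ℂ) (m : Fin M) :
    (sensingGram L lam B m m).re = 1 + L * lam m * ∑ j, ‖B m j‖ ^ 2 := by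
  rw [sensingGram, Matrix.add_apply, Matrix.one_apply_eq, Matrix.smul_apply, Matrix.mul_apply,
    Complex.add_re, Complex.one_re, smul_eq_mul, ← Complex.ofReal_natCast, Complex.re_ofReal_mul,
    Complex.re_sum, mul_assoc,
    Finset.mul_sum _ _ (lam m)]
  congr 2
  refine Finset.sum_congr rfl fun j _ => ?_
  rw [Matrix.conjTranspose_apply, Matrix.diagonal_mul, Complex.star_def, Complex.mul_conj,
    Complex.ofReal_re, Complex.normSq_eq_norm_sq, norm_mul, mul_pow, Complex.norm_real,
    Real.norm_eq_abs, sq_abs, Real.sq_sqrt (hlam m).le]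

theorem sensingGram_diagonal {M : ℕ} (L : ℕ) {lam : Fin M → ℝ} (hlam : ∀ m, 0 < lam m)
    {s : Fin M → ℝ} (hs : ∀ m, 0 ≤ s m) :
    sensingGram L lam (Matrix.diagonal fun m => ((√(s m) : ℝ) : ℂ)) =
      Matrix.diagonal fun m => ((1 + L * lam m * s m : ℝ) : ℂ) := by
  rw [sensingGram, Matrix.diagonal_mul_diagonal, Matrix.diagonal_conjTranspose,
    Matrix.diagonal_mul_diagonal, ← Matrix.diagonal_one, ← Matrix.diagonal_smul,
    Matrix.diagonal_add]
  congr 1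
  ext m
  have h : (√(lam m) * √(s m)) * (√(lam m) * √(s m)) = lam m * s m := by
    rw [mul_mul_mul_comm, Real.mul_self_sqrt (hlam m).le, Real.mul_self_sqrt (hs m)]
  simp only [Pi.smul_apply, Pi.star_apply, ← Complex.ofReal_mul, Complex.star_def,
    Complex.conj_ofReal, h, smul_eq_mul]
  push_cast
  ring

theorem precoder_mem_feasiblePrecoders {M : ℕ} {U : Matrix (Fin M) (Fin M) ℂ}
    (hU : U ∈ Matrix.unitaryGroup (Fin M) ℂ) {s : Fin M → ℝ} (hs : ∀ m, 0 ≤ s m) :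
    precoder U s ∈ feasiblePrecoders M (∑ m, s m) := by
  have hUU : Uᴴ * U = 1 := Matrix.mem_unitaryGroup_iff'.1 hU
  change (precoder U s * (precoder U s)ᴴ).trace.re ≤ _
  rw [← trace_conjTranspose_unitary_mul hU, precoder, ← Matrix.mul_assoc, hUU, Matrix.one_mul,
    trace_mul_conjTranspose_re_eq]
  refine Finset.sum_le_sum fun m _ => ?_
  rw [Finset.sum_eq_single m (fun j _ hj => by simp [Matrix.diagonal_apply_ne' _ hj]) (by simp),
    Matrix.diagonal_apply_eq, Complex.norm_real, Real.norm_eq_abs, sq_abs, Real.sq_sqrt (hs m)]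

theorem isMaxOn_sensingObjective_waterFill {M L : ℕ} (hL : 0 < L)
    {R U : Matrix (Fin M) (Fin M) ℂ} {lam : Fin M → ℝ} (hlam : ∀ m, 0 < lam m)
    (hU : U ∈ Matrix.unitaryGroup (Fin M) ℂ)
    (hRU : R = U * Matrix.diagonal (fun m => (lam m : ℂ)) * Uᴴ) {ν : ℝ} (hν : 0 < ν) :
    IsMaxOn (sensingObjective L R) (feasiblePrecoders M (∑ m, waterFill L lam ν m))
      (precoder U (waterFill L lam ν)) := by
  intro W hW
  have hUU : Uᴴ * U = 1 := Matrix.mem_unitaryGroup_iff'.1 hU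
  set s := waterFill L lam ν with hs
  have hs0 : ∀ m, 0 ≤ s m := waterFill_nonneg L lam ν
  have hd : ∀ m, 0 < 1 + L * lam m * s m := fun m => by
    have := hs0 m
    have := (hlam m).le
    positivity
  change (W * Wᴴ).trace.re ≤ _ at hW
  rw [← trace_conjTranspose_unitary_mul hU, trace_mul_conjTranspose_re_eq] at hW
  change sensingObjective L R W ≤ sensingObjective L R (precoder U s)
  rw [sensingObjective_eq_sensingGram L hlam hRU, sensingObjective_eq_sensingGram L hlam hRU,
    precoder, ← Matrix.mul_assoc, hUU, Matrix.one_mul, sensingGram_diagonal L hlam hs0,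
    Matrix.det_diagonal, ← Complex.ofReal_prod, Complex.ofReal_re]
  refine div_le_div_of_nonneg_right ?_ (Real.log_pos one_lt_two).le
  -- The tangent point is the Gram matrix of the water-filling precoder itself; what remains is that
  -- the linear term is nonpositive on the feasible set.
  refine ((sensingGram_posDef L lam (Uᴴ * W)).log_det_re_le_sum hd).trans ?_
  rw [Real.log_prod fun m _ => (hd m).ne']
  refine add_le_of_nonpos_right ?_
  calc ∑ m, ((sensingGram L lam (Uᴴ * W) m m).re / (1 + L * lam m * s m) - 1)
      = ∑ m, L * lam m / (1 + L * lam m * s m) * (∑ j, ‖(Uᴴ * W) m j‖ ^ 2 - s m) := by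
        refine Finset.sum_congr rfl fun m _ => ?_
        rw [sensingGram_apply_self_re L hlam]
        have := (hd m).ne'
        field_simp
        ring
    _ ≤ ∑ m, ν * (∑ j, ‖(Uᴴ * W) m j‖ ^ 2 - s m) :=
        Finset.sum_le_sum fun m _ => waterFill_slope_mul_le hL hν (hlam m)
          (Finset.sum_nonneg fun _ _ => by positivity)
    _ = ν * (∑ m, ∑ j, ‖(Uᴴ * W) m j‖ ^ 2 - ∑ m, s m) := by
        rw [← Finset.mul_sum, Finset.sum_sub_distrib]
    _ ≤ 0 := mul_nonpos_of_nonneg_of_nonpos hν.le (by linarith)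

/-! ### The ergodic rate and its high-SNR limit -/

theorem ProbabilityTheory.HasLaw.integrable_comp {Ω α : Type*} [MeasurableSpace Ω]
    [MeasurableSpace α] {P : Measure Ω} {μ : Measure α} {X : Ω → α} (hX : HasLaw X μ P) {f : α → ℝ}
    (hf : Integrable f μ) : Integrable (fun ω => f (X ω)) P := by
  rw [← hX.map_eq] at hf
  exact hf.comp_aemeasurable hX.aemeasurable

theorem integrable_logb_one_add_gammaMeasure_nat (n : ℕ) {s : ℝ} (hs : 0 ≤ s) :
    Integrable (fun x => Real.logb 2 (1 + s * x)) (gammaMeasure ((n : ℝ) + 1) 1) :=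
  (integrable_log_one_add_gammaMeasure_nat n hs).div_const _

theorem integrable_sumCommRate {Ω : Type*} [MeasurableSpace Ω] {Pr : Measure Ω} {K M n : ℕ}
    {H : Fin M → Ω → Matrix (Fin K) (Fin M) ℂ} {P : Matrix (Fin M) (Fin M) ℂ}
    (hlaw : ∀ m, HasLaw (fun ω => zfGain P (H m ω) m) (gammaMeasure ((n : ℝ) + 1) 1) Pr)
    {s : Fin M → ℝ} (hs : ∀ m, 0 ≤ s m) :
    Integrable (fun ω => sumCommRate P s fun m => H m ω) Pr :=
  integrable_finsetSum _ fun m _ =>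
    (hlaw m).integrable_comp (integrable_logb_one_add_gammaMeasure_nat n (hs m))

theorem integral_sumCommRate {Ω : Type*} [MeasurableSpace Ω] {Pr : Measure Ω} {K M n : ℕ}
    {H : Fin M → Ω → Matrix (Fin K) (Fin M) ℂ} {P : Matrix (Fin M) (Fin M) ℂ}
    (hlaw : ∀ m, HasLaw (fun ω => zfGain P (H m ω) m) (gammaMeasure ((n : ℝ) + 1) 1) Pr)
    {s : Fin M → ℝ} (hs : ∀ m, 0 ≤ s m) :
    ∫ ω, sumCommRate P s (fun m => H m ω) ∂Pr =
      ∑ m, ∫ x, Real.logb 2 (1 + s m * x) ∂(gammaMeasure ((n : ℝ) + 1) 1) := by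
  unfold sumCommRate
  rw [integral_finsetSum _ fun m _ =>
    (hlaw m).integrable_comp (integrable_logb_one_add_gammaMeasure_nat n (hs m))]
  refine Finset.sum_congr rfl fun m _ => ?_
  exact (hlaw m).integral_comp
    (integrable_logb_one_add_gammaMeasure_nat n (hs m)).aestronglyMeasurable

/-- Every power lies between `1/ν - 1/(L λ_j)` and `1/ν`; summing over `j` pins `p / M` near `1/ν`
too, with an error independent of `p`. -/
theorem abs_waterFill_sub_le {M L : ℕ} {lam : Fin M → ℝ} (hlam : ∀ m, 0 < lam m)
    {ν p : ℝ} (hν : 0 < ν) (hp : ∑ m, waterFill L lam ν m = p) (m : Fin M) :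
    |waterFill L lam ν m - p / M| ≤ ∑ j, 1 / (L * lam j) := by
  have hM : (0 : ℝ) < M := by exact_mod_cast m.pos
  have hc : ∀ j, 0 ≤ 1 / (L * lam j) := fun j => by
    have := (hlam j).le
    positivity
  have hν' : 0 < 1 / ν := by positivity
  have hub : ∀ j, waterFill L lam ν j ≤ 1 / ν := fun j =>
    max_le hν'.le (by linarith [hc j])
  have hlb : ∀ j, 1 / ν - 1 / (L * lam j) ≤ waterFill L lam ν j := fun j => le_max_right _ _
  have h1 : p ≤ M * (1 / ν) := by
    rw [← hp]
    exact (Finset.sum_le_sum fun j _ => hub j).trans (by simp)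
  have h2 : M * (1 / ν) - ∑ j, 1 / (L * lam j) ≤ p := by
    rw [← hp]
    refine le_trans (by simp) (Finset.sum_le_sum fun j _ => hlb j)
  have hcm : 1 / (L * lam m) ≤ ∑ j, 1 / (L * lam j) :=
    Finset.single_le_sum (fun j _ => hc j) (Finset.mem_univ m)
  have h3 : p / M ≤ 1 / ν := by
    rw [div_le_iff₀ hM]
    linarith
  have h4 : 1 / ν - ∑ j, 1 / (L * lam j) ≤ p / M := by
    rw [le_div_iff₀ hM]
    have hM1 : (1 : ℝ) ≤ M := by exact_mod_cast m.pos
    have hC : 0 ≤ ∑ j, 1 / (L * lam j) := Finset.sum_nonneg fun j _ => hc j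
    nlinarith
  rw [abs_le]
  constructor <;> linarith [hub m, hlb m]

theorem tendsto_waterFill_div {M L : ℕ} {lam : Fin M → ℝ} (hlam : ∀ m, 0 < lam m) {ν : ℝ → ℝ}
    (hν : ∀ p, 0 < p → 0 < ν p ∧ ∑ m, waterFill L lam (ν p) m = p) (m : Fin M) :
    Tendsto (fun p => waterFill L lam (ν p) m / p) atTop (𝓝 (1 / M)) := by
  rw [tendsto_iff_norm_sub_tendsto_zero]
  refine squeeze_zero' (Eventually.of_forall fun _ => norm_nonneg _) ?_
    ((tendsto_const_nhds (x := ∑ j, 1 / (L * lam j))).div_atTop tendsto_id)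
  filter_upwards [eventually_gt_atTop 0] with p hp
  have h := abs_waterFill_sub_le hlam (hν p hp).1 (hν p hp).2 m
  rw [id, Real.norm_eq_abs, le_div_iff₀ hp]
  calc |waterFill L lam (ν p) m / p - 1 / M| * p
      = |(waterFill L lam (ν p) m / p - 1 / M) * p| := by rw [abs_mul, abs_of_pos hp]
    _ = |waterFill L lam (ν p) m - p / M| := by
        congr 1
        field_simp
    _ ≤ _ := h

theorem tendsto_ergodic_waterFill_sub {M L n : ℕ} {lam : Fin M → ℝ} (hlam : ∀ m, 0 < lam m)
    {ν : ℝ → ℝ} (hν : ∀ p, 0 < p → 0 < ν p ∧ ∑ m, waterFill L lam (ν p) m = p) (m : Fin M) :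
    Tendsto (fun p => ∫ x, Real.logb 2 (1 + waterFill L lam (ν p) m * x)
        ∂(gammaMeasure ((n : ℝ) + 1) 1) -
      (Real.logb 2 p - Real.logb 2 M + realDigamma ((n : ℝ) + 1) / Real.log 2)) atTop (𝓝 0) := by
  have hM : (0 : ℝ) < M := by exact_mod_cast m.pos
  have hdiv := tendsto_waterFill_div hlam hν m
  have hM' : (0 : ℝ) < 1 / M := by positivity
  have hs : Tendsto (fun p => waterFill L lam (ν p) m) atTop atTop := by
    refine (hdiv.pos_mul_atTop hM' tendsto_id).congr' ?_
    filter_upwards [eventually_gt_atTop 0] with p hp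
    simp only [id]
    field_simp
  have hlog : Tendsto (fun p => Real.logb 2 (waterFill L lam (ν p) m / p)) atTop
      (𝓝 (Real.logb 2 (1 / M))) :=
    (hdiv.log hM'.ne').div_const _
  have h := (((tendsto_integral_logb_one_add_sub_logb n).comp hs).add hlog).sub_const
    (realDigamma ((n : ℝ) + 1) / Real.log 2 - Real.logb 2 M)
  rw [one_div, Real.logb_inv, show realDigamma ((n : ℝ) + 1) / Real.log 2 + -Real.logb 2 M -
    (realDigamma ((n : ℝ) + 1) / Real.log 2 - Real.logb 2 M) = 0 by ring] at h
  refine h.congr' ?_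
  filter_upwards [eventually_gt_atTop 0, hs.eventually_gt_atTop 0] with p hp hsp
  rw [Function.comp_apply, Real.logb_div hsp.ne' hp.ne']
  ring

theorem tendsto_div_logb_of_tendsto_sub {R : ℝ → ℝ} {c a b : ℝ}
    (h : Tendsto (fun p => R p - c * (Real.logb 2 p - a + b)) atTop (𝓝 0)) :
    Tendsto (fun p => R p / Real.logb 2 p) atTop (𝓝 c) := by
  have hlog : Tendsto (Real.logb 2) atTop atTop := Real.tendsto_logb_atTop one_lt_two
  have h1 := ((h.add_const (c * (b - a))).div_atTop hlog).add_const c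
  rw [zero_add] at h1
  refine h1.congr' ?_
  filter_upwards [hlog.eventually_gt_atTop 0] with p hp
  field_simp
  ring

theorem theorem2 {Ω : Type*} [MeasurableSpace Ω] (Pr : Measure Ω) [IsProbabilityMeasure Pr]
    (K M L : ℕ) (hM : 0 < M) (hMK : M ≤ K) (hL : 0 < L)
    -- the communication channels
    (H : Fin M → Ω → Matrix (Fin K) (Fin M) ℂ) (hH : ∀ m, IsRayleigh Pr (H m))
    -- the target correlation matrix and its eigendecomposition
    (R U : Matrix (Fin M) (Fin M) ℂ) (lam : Fin M → ℝ) (hR : R.PosDef)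
    (hU : U ∈ Matrix.unitaryGroup (Fin M) ℂ)
    (hRU : R = U * Matrix.diagonal (fun m => (lam m : ℂ)) * Uᴴ)
    -- the water level of each power budget
    (ν : ℝ → ℝ)
    (hν : ∀ p, 0 < p → 0 < ν p ∧ ∑ m, waterFill L lam (ν p) m = p) :
    -- the water-filling precoder is sensing-centric: it maximizes the sensing rate
    (∀ p, 0 < p →
      precoder U (waterFill L lam (ν p)) ∈ feasiblePrecoders M p ∧
      IsMaxOn (sensingObjective L R) (feasiblePrecoders M p)
        (precoder U (waterFill L lam (ν p)))) ∧
    -- the gains are Gamma distributed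
    (∀ m, HasLaw (fun ω => zfGain U (H m ω) m) (gammaMeasure (((K - M : ℕ) : ℝ) + 1) 1) Pr) ∧
    -- the closed form of the sum ergodic rate
    (∀ p, 0 < p →
      Integrable (fun ω => sumCommRate U (waterFill L lam (ν p)) (fun m => H m ω)) Pr ∧
      ∫ ω, sumCommRate U (waterFill L lam (ν p)) (fun m => H m ω) ∂Pr =
        ∑ m with 0 < waterFill L lam (ν p) m, ∑ μ ∈ Finset.range (K - M + 1),
          (-1 / waterFill L lam (ν p) m) ^ (K - M - μ) / (((K - M - μ)! : ℝ) * Real.log 2) *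
          (-(Real.exp (1 / waterFill L lam (ν p) m) *
              expIntegralEi (-1 / waterFill L lam (ν p) m)) +
            ∑ i ∈ Finset.Icc 1 (K - M - μ),
              ((i - 1)! : ℝ) * (-1 / waterFill L lam (ν p) m) ^ (-(i : ℤ)))) ∧
    -- the high-SNR approximation
    Tendsto (fun p : ℝ =>
      (∫ ω, sumCommRate U (waterFill L lam (ν p)) (fun m => H m ω) ∂Pr) -
        M * (Real.logb 2 p - Real.logb 2 M + realDigamma (((K - M : ℕ) : ℝ) + 1) / Real.log 2))
      atTop (𝓝 0) ∧
    -- the high-SNR slope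
    Tendsto (fun p : ℝ =>
      (∫ ω, sumCommRate U (waterFill L lam (ν p)) (fun m => H m ω) ∂Pr) / Real.logb 2 p)
      atTop (𝓝 (M : ℝ)) := by
  have hlam := eigenvalue_pos_of_posDef hR hU hRU
  have hlaw := fun m => (hH m).hasLaw_zfGain hMK hU m
  have hs0 := fun p m => waterFill_nonneg L lam (ν p) m
  have hasymp : Tendsto (fun p : ℝ =>
      (∫ ω, sumCommRate U (waterFill L lam (ν p)) (fun m => H m ω) ∂Pr) -
        M * (Real.logb 2 p - Real.logb 2 M + realDigamma (((K - M : ℕ) : ℝ) + 1) / Real.log 2))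
      atTop (𝓝 0) := by
    have h := tendsto_finsetSum Finset.univ fun m _ =>
      tendsto_ergodic_waterFill_sub (n := K - M) hlam hν m
    rw [Finset.sum_const_zero] at h
    refine h.congr fun p => ?_
    rw [integral_sumCommRate hlaw (hs0 p), Finset.sum_sub_distrib]
    simp
    ring
  refine ⟨fun p hp => ?_, hlaw, fun p hp => ⟨integrable_sumCommRate hlaw (hs0 p), ?_⟩, hasymp,
    tendsto_div_logb_of_tendsto_sub hasymp⟩
  · obtain ⟨hνp, hsum⟩ := hν p hp
    have h1 := precoder_mem_feasiblePrecoders hU (hs0 p)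
    have h2 := isMaxOn_sensingObjective_waterFill hL hlam hU hRU hνp
    rw [hsum] at h1 h2
    exact ⟨h1, h2⟩
  · rw [integral_sumCommRate hlaw (hs0 p), Finset.sum_filter]
    refine Finset.sum_congr rfl fun m _ => ?_
    split_ifs with hm
    · exact integral_logb_one_add_gammaMeasure_nat (K - M) hm
    -- An inactive user contributes `log₂ 1 = 0`.
    · rw [le_antisymm (not_lt.1 hm) (hs0 p m)]
      simp
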